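/- Let $F$ be a field with $\operatorname{char} F\neq 2,3$; algebras are nonassociative $F$-algebras. Write $[x,y]=xy-yx$, $(x,y,z)=(xy)z-x(yz)$, and write commutators left-normed, $[x_1,x_2,\dots,x_m]=[\dots[[x_1,x_2],x_3],\dots,x_m]$. For $s\ge 1$ let $\mathrm{RL}_s$ be the variety of algebras defined by the identities $$(x,y,z)+(x,z,y)=0,\qquad (xy)(zt)=0,\qquad [x_1,x_2,\dots,x_{s+1}]=0 .$$ **Superalgebras.** For a $\mathbb Z_2$-graded algebra $A=A_0\oplus A_1$ let $\mathrm G(A)=G_0\otimes A_0+G_1\otimes A_1\subseteq G\otimes A$ be its Grassmann envelope, where $G=G_0\oplus G_1$ is the Grassmann algebra on countably many generators. $A$ is a $\mathcal V$-superalgebra if $\mathrm G(A)\in\mathcal V$. For $\varepsilon\in\{0,1\}$ let $A^{(\varepsilon)}$ be the superalgebra with basis $x$, $a_{i,j}$ $(i,j\ge 0)$, where $x$ is odd, $a_{i,j}$ is even iff $i\equiv j\pmod 2$, and $$x^2=\tfrac{\varepsilon}{2}a_{0,0},\quad a_{i,j}x=a_{i,j+1},\quad x\,a_{i,2j}=(-1)^i(a_{i,2j+1}-a_{i+1,2j}),$$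 $$x\,a_{i,2j+1}=\tfrac{(-1)^i}{2}\,(a_{i,2j+2}-2a_{i+1,2j+1}+a_{i+2,2j}),$$ all other products of basis elements being zero. Let $I^{(k)}$ be the ideal spanned by all $a_{i,j}$ with $i\ge 2k$, and put $A^{\langle 2k\rangle}=A^{(0)}/I^{(k)}$, $A^{\langle 2k+1\rangle}=A^{(1)}/I^{(k)}$ for $k\ge1$. **Allotted varieties.** Let $R_y$ be right multiplication by $y$. For $n\geq 1$ put $\varphi_n=[x_1,x_2,x_3,\dots,x_{n+1}]$ if $n$ is even and $\varphi_n=[x_1x_2,x_3,\dots,x_{n+1}]$ if $n$ is odd (so $\varphi_1=x_1x_2$). For $1\le n\le s$, a subvariety $\mathcal V\subseteq\mathrm{RL}_s$ is $n$-allotted if $\varphi_n\approx0$ in the free $\mathcal V$-algebra on $x_1,x_2,\dots$, where $f\approx g$ means that one of $f,g$ is obtained from the other one, say $h$, as $hR_{x_{j_1}}\cdots R_{x_{j_{2k}}}$ for some $k$ and some pairwise distinct variables on which $h$ does not depend. **Topological rank.** For a variety $\mathcal R$ and a proper subvariety $\mathcal M\subset\mathcal R$, let $\dim_{\mathcal R}\mathcal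 M$ be the least $d$ such that $\mathcal M$ is defined inside $\mathcal R$ by finitely many identities $f=0$, with each $f$ a nonzero homogeneous element of the free $\mathcal R$-algebra of degree at most $d$ ($\infty$ if there is no such $d$). Topologize the set $\wp(\mathcal V)$ of all subvarieties of $\mathcal V$ by the base consisting of the sets $$U_m(\mathcal R)=\{\mathcal R\}\cup\{\mathcal M\subsetneq\mathcal R:\dim_{\mathcal R}\mathcal M\ge m\},\qquad \mathcal R\in\wp(\mathcal V),\ m\in\mathbb N.$$ For a space $\Omega$ let $\Omega'$ be $\Omega$ without its isolated points, and $\Omega^{(m)}$ the $m$-fold iterate. The topological rank $r_t(\mathcal V)$ is the least $m$ with $\wp(\mathcal V)^{(m)}=\varnothing$, and $\aleph_0$ if there is none. **Statement.** For every $n\ge 2$: 1. $A^{\langle n\rangle}$ is an $\mathrm{RL}_n$-superalgebra, i.e. $\mathrm G(A^{\langle n\rangle})\in\mathrm{RL}_n$; 2. the variety generated by $\mathrm G(A^{\langle n\rangle})$, regarded as a subvariety of $\mathrm{RL}_s$ for any $s\ge n$, is $n$-allotted but not $(n-1)$-allotted; 3. $r_t(\mathrm{RL}_n)\ge n$. 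-/

import Mathlib

universe u

namespace SuperRank

open scoped TensorProduct

noncomputable section

/-! ## Nonassociative algebras, polynomials, identities and varieties -/

/-- A (not necessarily associative, not necessarily unital) algebra over the field `F`. -/
structure Alg (F : Type u) [Field F] : Type (u + 1) where
  carrier : Type u
  [ring : NonUnitalNonAssocRing carrier]
  [module : Module F carrier]
  [tower : IsScalarTower F carrier carrier]
  [comm : SMulCommClass F carrier carrier]

attribute [instance] Alg.ring Alg.module Alg.tower Alg.comm

/-- Nonassociative polynomials without constant term over `F` in the variables `x 0, x 1, …`:
the free nonassociative algebra on a countable set of generators. -/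
abbrev Poly (F : Type u) [Field F] : Type u := FreeNonUnitalNonAssocAlgebra F ℕ

/-- The variable with index `i`. -/
def x (F : Type u) [Field F] (i : ℕ) : Poly F := FreeNonUnitalNonAssocAlgebra.of F i

/-- The algebra `A` satisfies the identity `f = 0`. -/
def Alg.Satisfies {F : Type u} [Field F] (A : Alg F) (f : Poly F) : Prop :=
  ∀ v : ℕ → A.carrier, FreeNonUnitalNonAssocAlgebra.lift F v f = 0

/-- A variety: the class of all algebras that satisfy some set of identities. -/
@[ext]
structure Variety (F : Type u) [Field F] : Type (u + 1) where
  algs : Set (Alg F)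
  exists_identities : ∃ S : Set (Poly F), algs = {A | ∀ f ∈ S, A.Satisfies f}

/-- `𝓜 ≤ 𝓥` means that `𝓜` is a subvariety of `𝓥`, and `𝓜 < 𝓥` that it is a proper one. -/
instance (F : Type u) [Field F] : PartialOrder (Variety F) :=
  PartialOrder.lift Variety.algs fun _ _ h => Variety.ext h

/-- The variety defined by a set of identities. -/
def Variety.ofIdentities {F : Type u} [Field F] (S : Set (Poly F)) : Variety F where
  algs := {A | ∀ f ∈ S, A.Satisfies f}
  exists_identities := ⟨S, rfl⟩

/-- The variety generated by the algebra `A`: all algebras satisfying every identity of `A`. -/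
def Variety.generatedBy {F : Type u} [Field F] (A : Alg F) : Variety F :=
  Variety.ofIdentities {f | A.Satisfies f}

/-- `f = 0` is an identity of the variety `𝓥`; equivalently, the image of `f` in the free
`𝓥`-algebra (the quotient of `Poly F` by the ideal of all identities of `𝓥`) is zero. -/
def Variety.IsIdentity {F : Type u} [Field F] (V : Variety F) (f : Poly F) : Prop :=
  ∀ A ∈ V.algs, A.Satisfies f

/-! ## Right alternative metabelian Lie-nilpotent algebras -/

section Words

variable {A : Type u} [NonUnitalNonAssocRing A]

/-- The commutator `ab - ba`. -/
def com (a b : A) : A := a * b - b * a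

/-- The associator `(ab)c - a(bc)`. -/
def ass (a b c : A) : A := a * b * c - a * (b * c)

/-- The left-normed commutator `[…[[a, v 0], v 1], …, v (m - 1)]`. -/
def leftCom (a : A) (v : ℕ → A) : ℕ → A
  | 0 => a
  | m + 1 => com (leftCom a v m) (v m)

end Words

/-- The left-hand side of the linearised right alternative identity `(x,y,z) + (x,z,y) = 0`. -/
def rightAlt (F : Type u) [Field F] : Poly F :=
  ass (x F 0) (x F 1) (x F 2) + ass (x F 0) (x F 2) (x F 1)

/-- The left-hand side of the metabelian identity `(xy)(zt) = 0`. -/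
def metab (F : Type u) [Field F] : Poly F :=
  (x F 0 * x F 1) * (x F 2 * x F 3)

/-- The left-hand side `[…[[x₁,x₂],x₃],…,x_{s+1}]` (`s` brackets) of the identity of
Lie-nilpotency of step `s`. -/
def lieNil (F : Type u) [Field F] (s : ℕ) : Poly F :=
  leftCom (x F 0) (fun i => x F (i + 1)) s

/-- The variety `RL_s` of right alternative metabelian algebras, Lie-nilpotent of step `s`. -/
def RL (F : Type u) [Field F] (s : ℕ) : Variety F :=
  Variety.ofIdentities {rightAlt F, metab F, lieNil F s}

/-! ## Allotted varieties -/

/-- `f` does not depend on the variables with indices in `J`. -/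
def IndepOf {F : Type u} [Field F] (f : Poly F) (J : Set ℕ) : Prop :=
  f ∈ NonUnitalAlgebra.adjoin F (x F '' Jᶜ)

/-- The polynomial `f R_{j 0} R_{j 1} ⋯ R_{j (m - 1)} = (…((f x_{j 0}) x_{j 1}) …) x_{j (m - 1)}`. -/
def rightMul {F : Type u} [Field F] (f : Poly F) {m : ℕ} (j : Fin m → ℕ) : Poly F :=
  (List.ofFn j).foldl (fun g i => g * x F i) f

/-- In the free `V`-algebra, `g = f R_{j₁} ⋯ R_{j_{2k}}` for some `k` and some pairwise distinct
variables on which `f` does not depend. -/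
def RightStep {F : Type u} [Field F] (V : Variety F) (f g : Poly F) : Prop :=
  ∃ (k : ℕ) (j : Fin (2 * k) → ℕ), Function.Injective j ∧ IndepOf f (Set.range j) ∧
    V.IsIdentity (g - rightMul f j)

/-- The relation `f ≈ g` in the free `V`-algebra. -/
def Approx {F : Type u} [Field F] (V : Variety F) (f g : Poly F) : Prop :=
  RightStep V f g ∨ RightStep V g f

/-- The polynomial `φ(x₁,…,x_{n+1})`: the commutator `[…[[x₁,x₂],x₃],…,x_{n+1}]` for even `n`
and `[…[x₁x₂,x₃],…,x_{n+1}]` for odd `n`. -/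
def phi (F : Type u) [Field F] (n : ℕ) : Poly F :=
  if Even n then leftCom (x F 0) (fun i => x F (i + 1)) n
  else leftCom (x F 0 * x F 1) (fun i => x F (i + 2)) (n - 1)

/-- `V` is an `n`-allotted variety (`1 ≤ n ≤ s`): a subvariety of `RL_s` whose free algebra
satisfies `φ(x₁,…,x_{n+1}) ≈ 0`. -/
def IsAllotted {F : Type u} [Field F] (s n : ℕ) (V : Variety F) : Prop :=
  1 ≤ n ∧ n ≤ s ∧ V ≤ RL F s ∧ Approx V (phi F n) 0

/-! ## The topological rank -/

/-- `f` is homogeneous of degree `d`. -/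
def IsHomogeneous {F : Type u} [Field F] (f : Poly F) (d : ℕ) : Prop :=
  ∀ m ∈ f.coeff.support, m.length = d

/-- The (total) degree of a polynomial. -/
def degree {F : Type u} [Field F] (f : Poly F) : ℕ :=
  f.coeff.support.sup FreeMagma.length

/-- `S` is a system distinguishing `M` from `V`: finitely many homogeneous polynomials that are
nonzero in the free `V`-algebra and define `M` inside `V`. -/
def IsDistinguishing {F : Type u} [Field F] (V M : Variety F) (S : Finset (Poly F)) : Prop :=
  (∀ f ∈ S, (∃ d, IsHomogeneous f d) ∧ ¬ V.IsIdentity f) ∧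
    M.algs = {A | A ∈ V.algs ∧ ∀ f ∈ S, A.Satisfies f}

/-- The dimension of `M` with respect to `V`: the least degree of a system distinguishing `M`
from `V` (and `⊤` if there is no such system, which does not occur when `V` is Spechtian
over an infinite field). -/
def dim {F : Type u} [Field F] (V M : Variety F) : ℕ∞ :=
  ⨅ (S : Finset (Poly F)) (_ : IsDistinguishing V M S), ((S.sup degree : ℕ) : ℕ∞)

/-- The set of all subvarieties of `V`. -/
def Subvarieties {F : Type u} [Field F] (V : Variety F) : Type (u + 1) :=
  {M : Variety F // M ≤ V}

/-- The set `U_n(R)`: the variety `R` together with all its proper subvarieties whose dimension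
with respect to `R` is at least `n`. -/
def nbhd {F : Type u} [Field F] {V : Variety F} (n : ℕ) (R : Subvarieties V) :
    Set (Subvarieties V) :=
  {M | M.1 < R.1 ∧ (n : ℕ∞) ≤ dim R.1 M.1} ∪ {R}

/-- The topology on the set of subvarieties of `V` generated by the sets `U_n(R)`. -/
instance {F : Type u} [Field F] (V : Variety F) : TopologicalSpace (Subvarieties V) :=
  TopologicalSpace.generateFrom {O | ∃ (R : Subvarieties V) (n : ℕ), O = nbhd n R}

/-- `Ω'`: the subspace `Ω` with all its isolated points removed. -/
def derived {X : Type*} [TopologicalSpace X] (Ω : Set X) : Set X :=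
  {p | p ∈ Ω ∧ ¬ ∃ O : Set X, IsOpen O ∧ O ∩ Ω = {p}}

/-- The topological rank of a space `Ω`: the least `n` with `Ω⁽ⁿ⁾ = ∅`, and `⊤` (standing for
`ℵ₀`) if there is no such `n`. -/
def topRankSet {X : Type*} [TopologicalSpace X] (Ω : Set X) : ℕ∞ :=
  ⨅ (n : ℕ) (_ : derived^[n] Ω = ∅), (n : ℕ∞)

/-- The topological rank of a variety. -/
def topRank {F : Type u} [Field F] (V : Variety F) : ℕ∞ :=
  topRankSet (Set.univ : Set (Subvarieties V))

/-! ## Superalgebras and Grassmann envelopes -/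

/-- A superalgebra structure (a `ℤ/2`-grading) on a nonassociative algebra: `part 0` is the even
part and `part 1` the odd part. -/
structure Superalgebra (F : Type u) [Field F] (A : Type u) [NonUnitalNonAssocRing A]
    [Module F A] where
  part : ZMod 2 → Submodule F A
  isCompl : IsCompl (part 0) (part 1)
  mul_mem : ∀ i j a b, a ∈ part i → b ∈ part j → a * b ∈ part (i + j)

/-- The Grassmann algebra on countably many generators. -/
abbrev Grassmann (F : Type u) [Field F] : Type u := ExteriorAlgebra F (ℕ →₀ F)

/-- The even part (`i = 0`) and the odd part (`i = 1`) of the Grassmann algebra. -/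
def grassmannPart (F : Type u) [Field F] (i : ZMod 2) : Submodule F (Grassmann F) :=
  CliffordAlgebra.evenOdd (0 : QuadraticForm F (ℕ →₀ F)) i

section Envelope

variable {F : Type u} [Field F] {A : Type u} [NonUnitalNonAssocRing A] [Module F A]
  [IsScalarTower F A A] [SMulCommClass F A A]

/-- The subspace `G_i ⊗ A_i` of `G ⊗ A`. -/
def envelopePart (𝒜 : Superalgebra F A) (i : ZMod 2) : Submodule F (Grassmann F ⊗[F] A) :=
  Submodule.span F {t | ∃ g ∈ grassmannPart F i, ∃ a ∈ 𝒜.part i, t = g ⊗ₜ[F] a}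

theorem envelopePart_mul (𝒜 : Superalgebra F A) (i j : ZMod 2) {s t : Grassmann F ⊗[F] A}
    (hs : s ∈ envelopePart 𝒜 i) (ht : t ∈ envelopePart 𝒜 j) :
    s * t ∈ envelopePart 𝒜 (i + j) := by
  unfold envelopePart at hs
  induction hs using Submodule.span_induction with
  | zero => rw [zero_mul]; exact zero_mem _
  | add a b _ _ ha hb => rw [add_mul]; exact add_mem ha hb
  | smul c a _ ha => rw [smul_mul_assoc]; exact Submodule.smul_mem _ _ ha
  | mem s hs =>
    unfold envelopePart at ht
    induction ht using Submodule.span_induction with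
    | zero => rw [mul_zero]; exact zero_mem _
    | add a b _ _ ha hb => rw [mul_add]; exact add_mem ha hb
    | smul c a _ ha => rw [mul_smul_comm]; exact Submodule.smul_mem _ _ ha
    | mem t ht =>
      obtain ⟨g, hg, a, ha, rfl⟩ := hs
      obtain ⟨h, hh, b, hb, rfl⟩ := ht
      rw [Algebra.TensorProduct.tmul_mul_tmul]
      exact Submodule.subset_span ⟨g * h,
        CliffordAlgebra.evenOdd_mul_le _ i j (Submodule.mul_mem_mul hg hh),
        a * b, 𝒜.mul_mem i j a b ha hb, rfl⟩

/-- The Grassmann envelope `G(A) = G₀ ⊗ A₀ + G₁ ⊗ A₁`, a subalgebra of `G ⊗ A`. -/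
def envelope (𝒜 : Superalgebra F A) : NonUnitalSubalgebra F (Grassmann F ⊗[F] A) where
  __ := envelopePart 𝒜 0 ⊔ envelopePart 𝒜 1
  mul_mem' := by
    intro s t hs ht
    change s ∈ envelopePart 𝒜 0 ⊔ envelopePart 𝒜 1 at hs
    change t ∈ envelopePart 𝒜 0 ⊔ envelopePart 𝒜 1 at ht
    change s * t ∈ envelopePart 𝒜 0 ⊔ envelopePart 𝒜 1
    obtain ⟨s₀, hs₀, s₁, hs₁, rfl⟩ := Submodule.mem_sup.1 hs
    obtain ⟨t₀, ht₀, t₁, ht₁, rfl⟩ := Submodule.mem_sup.1 ht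
    have h00 : s₀ * t₀ ∈ envelopePart 𝒜 0 := envelopePart_mul 𝒜 0 0 hs₀ ht₀
    have h01 : s₀ * t₁ ∈ envelopePart 𝒜 1 := envelopePart_mul 𝒜 0 1 hs₀ ht₁
    have h10 : s₁ * t₀ ∈ envelopePart 𝒜 1 := envelopePart_mul 𝒜 1 0 hs₁ ht₀
    have h11 : s₁ * t₁ ∈ envelopePart 𝒜 0 := envelopePart_mul 𝒜 1 1 hs₁ ht₁
    rw [add_mul, mul_add, mul_add]
    exact add_mem (add_mem (Submodule.mem_sup_left h00) (Submodule.mem_sup_right h01))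
      (add_mem (Submodule.mem_sup_right h10) (Submodule.mem_sup_left h11))

/-- The Grassmann envelope as an algebra over `F`. -/
def envelopeAlg (𝒜 : Superalgebra F A) : Alg F := ⟨envelope 𝒜⟩

/-- `A` is a `V`-superalgebra: its Grassmann envelope lies in `V`. -/
def Superalgebra.IsIn (𝒜 : Superalgebra F A) (V : Variety F) : Prop :=
  envelopeAlg 𝒜 ∈ V.algs

end Envelope

/-! ## The superalgebras `A^(ε)` and `A^⟨n⟩` -/

/-- The index set of the basis `x, a_{i,j}` of `A^(ε)`. -/
inductive Idx : Type
  | x : Idx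
  | a (i j : ℕ) : Idx

/-- The parity of a basis element: `x` is odd, and `a_{i,j}` is even iff `i ≡ j (mod 2)`. -/
def Idx.parity : Idx → ZMod 2
  | .x => 1
  | .a i j => (i : ZMod 2) + (j : ZMod 2)

/-- The underlying vector space of `A^(ε)`, with basis `x, a_{i,j}`. -/
def ASup (F : Type u) [Field F] (_ε : F) : Type u := Idx →₀ F

section ASup

variable {F : Type u} [Field F] (ε : F)

instance : AddCommGroup (ASup F ε) := inferInstanceAs (AddCommGroup (Idx →₀ F))
instance : Module F (ASup F ε) := inferInstanceAs (Module F (Idx →₀ F))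

/-- The basis element of `A^(ε)` with a given index. -/
def bas (b : Idx) : ASup F ε := Finsupp.single b (1 : F)

/-- The products of the basis elements of `A^(ε)`. -/
def basMul : Idx → Idx → ASup F ε
  | .x, .x => (ε / 2) • bas ε (.a 0 0)
  | .a i j, .x => bas ε (.a i (j + 1))
  | .x, .a i j =>
      if Even j then ((-1 : F) ^ i) • (bas ε (.a i (j + 1)) - bas ε (.a (i + 1) j))
      else ((-1 : F) ^ i / 2) •
        (bas ε (.a i (j + 1)) - (2 : F) • bas ε (.a (i + 1) j) + bas ε (.a (i + 2) (j - 1)))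
  | .a _ _, .a _ _ => 0

/-- The multiplication of `A^(ε)`, the bilinear extension of `basMul`. -/
def mulMap : ASup F ε →ₗ[F] ASup F ε →ₗ[F] ASup F ε :=
  Finsupp.linearCombination F fun b => Finsupp.linearCombination F fun c => basMul ε b c

instance : NonUnitalNonAssocRing (ASup F ε) where
  mul a b := mulMap ε a b
  left_distrib a b c := (mulMap ε a).map_add b c
  right_distrib a b c := (mulMap ε).map_add₂ a b c
  zero_mul a := (mulMap ε).map_zero₂ a
  mul_zero a := (mulMap ε a).map_zero

theorem mul_def' (a b : ASup F ε) : a * b = mulMap ε a b := rfl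

instance : IsScalarTower F (ASup F ε) (ASup F ε) :=
  ⟨fun c a b => (mulMap ε).map_smul₂ c a b⟩

instance : SMulCommClass F (ASup F ε) (ASup F ε) :=
  ⟨fun c a b => ((mulMap ε a).map_smul c b).symm⟩

theorem bas_mul_bas (b c : Idx) : bas ε b * bas ε c = basMul ε b c := by
  rw [mul_def', mulMap]
  unfold bas
  erw [Finsupp.linearCombination_single, one_smul, Finsupp.linearCombination_single, one_smul]

theorem mem_span_bas (a : ASup F ε) : a ∈ Submodule.span F (Set.range (bas ε)) := by
  have h : ∀ a : Idx →₀ F, a ∈ Submodule.span F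
      (Set.range fun b : Idx => (Finsupp.single b (1 : F) : Idx →₀ F)) := by
    intro a
    induction a using Finsupp.induction_linear with
    | zero => exact zero_mem _
    | add f g hf hg => exact add_mem hf hg
    | single b c =>
      rw [← Finsupp.smul_single_one]
      exact Submodule.smul_mem _ _ (Submodule.subset_span ⟨b, rfl⟩)
  exact h a

/-- The ideal `I^(k)`: the span of all `a_{i,j}` with `i ≥ 2k`. -/
def idealI (k : ℕ) : Submodule F (ASup F ε) :=
  Submodule.span F {v | ∃ i j : ℕ, 2 * k ≤ i ∧ v = bas ε (.a i j)}

/-- The homogeneous component of `A^(ε)` of parity `p`. -/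
def aPart (p : ZMod 2) : Submodule F (ASup F ε) :=
  Submodule.span F {v | ∃ b : Idx, b.parity = p ∧ v = bas ε b}

theorem idealI_mul_mem (k : ℕ) (a b : ASup F ε) (hb : b ∈ idealI ε k) :
    a * b ∈ idealI ε k ∧ b * a ∈ idealI ε k := by
  have hmem : ∀ {i j : ℕ}, 2 * k ≤ i → bas ε (.a i j) ∈ idealI ε k :=
    fun {i j} h => Submodule.subset_span ⟨i, j, h, rfl⟩
  unfold idealI at hb
  induction hb using Submodule.span_induction with
  | zero => rw [mul_zero, zero_mul]; exact ⟨zero_mem _, zero_mem _⟩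
  | add u v _ _ hu hv =>
    rw [mul_add, add_mul]; exact ⟨add_mem hu.1 hv.1, add_mem hu.2 hv.2⟩
  | smul c u _ hu =>
    rw [smul_mul_assoc, mul_smul_comm]
    exact ⟨Submodule.smul_mem _ _ hu.1, Submodule.smul_mem _ _ hu.2⟩
  | mem b hb =>
    obtain ⟨i, j, hij, rfl⟩ := hb
    have ha : a ∈ Submodule.span F (Set.range (bas ε)) := mem_span_bas ε a
    induction ha using Submodule.span_induction with
    | zero => rw [mul_zero, zero_mul]; exact ⟨zero_mem _, zero_mem _⟩
    | add u v _ _ hu hv =>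
      rw [mul_add, add_mul]; exact ⟨add_mem hu.1 hv.1, add_mem hu.2 hv.2⟩
    | smul c u _ hu =>
      rw [smul_mul_assoc, mul_smul_comm]
      exact ⟨Submodule.smul_mem _ _ hu.1, Submodule.smul_mem _ _ hu.2⟩
    | mem a ha =>
      obtain ⟨c, rfl⟩ := ha
      rw [bas_mul_bas, bas_mul_bas]
      cases c with
      | a i' j' => exact ⟨zero_mem _, zero_mem _⟩
      | x =>
        refine ⟨?_, hmem hij⟩
        simp only [basMul]
        split_ifs
        · exact Submodule.smul_mem _ _ (sub_mem (hmem hij) (hmem (by omega)))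
        · exact Submodule.smul_mem _ _ (add_mem (sub_mem (hmem hij)
            (Submodule.smul_mem _ _ (hmem (by omega)))) (hmem (by omega)))

theorem idealI_eq (k : ℕ) : idealI ε k =
    (Finsupp.supported F F {b | ∃ i j : ℕ, 2 * k ≤ i ∧ b = Idx.a i j} :
      Submodule F (Idx →₀ F)) := by
  rw [Finsupp.supported_eq_span_single]
  unfold idealI
  congr 1
  ext v
  constructor
  · rintro ⟨i, j, h, rfl⟩; exact ⟨_, ⟨i, j, h, rfl⟩, rfl⟩
  · rintro ⟨_, ⟨i, j, h, rfl⟩, rfl⟩; exact ⟨i, j, h, rfl⟩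

theorem aPart_eq (p : ZMod 2) : aPart ε p =
    (Finsupp.supported F F {b | b.parity = p} : Submodule F (Idx →₀ F)) := by
  rw [Finsupp.supported_eq_span_single]
  unfold aPart
  congr 1
  ext v
  constructor
  · rintro ⟨b, h, rfl⟩; exact ⟨_, h, rfl⟩
  · rintro ⟨b, h, rfl⟩; exact ⟨b, h, rfl⟩

theorem aPart_sup : aPart ε 0 ⊔ aPart ε 1 = ⊤ := by
  rw [eq_top_iff]
  intro a _
  refine Submodule.span_le.2 ?_ (mem_span_bas ε a)
  rintro _ ⟨b, rfl⟩
  rcases (by decide : ∀ p : ZMod 2, p = 0 ∨ p = 1) b.parity with h | h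
  · exact Submodule.mem_sup_left (Submodule.subset_span ⟨b, h, rfl⟩)
  · exact Submodule.mem_sup_right (Submodule.subset_span ⟨b, h, rfl⟩)

theorem mem_supported_of_sub {s t r : Set Idx} (hst : Disjoint s t) (u v : Idx →₀ F)
    (hu : u ∈ Finsupp.supported F F s) (hv : v ∈ Finsupp.supported F F t)
    (h : u - v ∈ Finsupp.supported F F r) : u ∈ Finsupp.supported F F r := by
  rw [Finsupp.mem_supported'] at hu hv h ⊢
  intro b hb
  by_cases hs : b ∈ s
  · have h1 := h b hb
    rwa [Finsupp.sub_apply, hv b (Set.disjoint_left.1 hst hs), sub_zero] at h1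
  · exact hu b hs

theorem mem_idealI_of_sub (k : ℕ) (u v : ASup F ε) (hu : u ∈ aPart ε 0) (hv : v ∈ aPart ε 1)
    (h : u - v ∈ idealI ε k) : u ∈ idealI ε k := by
  rw [idealI_eq] at h ⊢
  rw [aPart_eq] at hu hv
  refine mem_supported_of_sub (Set.disjoint_left.2 fun b h0 h1 => ?_) u v hu hv h
  exact absurd ((show b.parity = 0 from h0).symm.trans h1) (by decide)

theorem bas_mem_aPart (b : Idx) {p : ZMod 2} (h : b.parity = p) : bas ε b ∈ aPart ε p :=
  Submodule.subset_span ⟨b, h, rfl⟩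

theorem basMul_mem (b c : Idx) : basMul ε b c ∈ aPart ε (b.parity + c.parity) := by
  have h2 : (2 : ZMod 2) = 0 := rfl
  cases b with
  | x =>
    cases c with
    | x => exact Submodule.smul_mem _ _ (bas_mem_aPart ε _ (by decide))
    | a i j =>
      simp only [basMul]
      split_ifs with hj
      · exact Submodule.smul_mem _ _ (sub_mem
          (bas_mem_aPart ε _ (by simp only [Idx.parity]; push_cast; ring))
          (bas_mem_aPart ε _ (by simp only [Idx.parity]; push_cast; ring)))
      · obtain ⟨m, rfl⟩ := Nat.not_even_iff_odd.1 hj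
        refine Submodule.smul_mem _ _ (add_mem (sub_mem
          (bas_mem_aPart ε _ (by simp only [Idx.parity]; push_cast; ring))
          (Submodule.smul_mem _ _
            (bas_mem_aPart ε _ (by simp only [Idx.parity]; push_cast; ring))))
          (bas_mem_aPart ε _ ?_))
        simp only [Idx.parity, Nat.add_sub_cancel]
        push_cast
        linear_combination
  | a i j =>
    cases c with
    | x => exact bas_mem_aPart ε _ (by simp only [Idx.parity]; push_cast; ring)
    | a i' j' => exact zero_mem _

theorem aPart_mul (p q : ZMod 2) (a b : ASup F ε) (ha : a ∈ aPart ε p) (hb : b ∈ aPart ε q) :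
    a * b ∈ aPart ε (p + q) := by
  unfold aPart at ha
  induction ha using Submodule.span_induction with
  | zero => rw [zero_mul]; exact zero_mem _
  | add u v _ _ hu hv => rw [add_mul]; exact add_mem hu hv
  | smul c u _ hu => rw [smul_mul_assoc]; exact Submodule.smul_mem _ _ hu
  | mem u hu =>
    unfold aPart at hb
    induction hb using Submodule.span_induction with
    | zero => rw [mul_zero]; exact zero_mem _
    | add u v _ _ hu hv => rw [mul_add]; exact add_mem hu hv
    | smul c u _ hu => rw [mul_smul_comm]; exact Submodule.smul_mem _ _ hu
    | mem v hv =>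
      obtain ⟨b, rfl, rfl⟩ := hu
      obtain ⟨c, rfl, rfl⟩ := hv
      rw [bas_mul_bas]
      exact basMul_mem ε b c

/-- The underlying vector space of the quotient `A^(ε) / I^(k)`. -/
def AQuot (F : Type u) [Field F] (ε : F) (k : ℕ) : Type u := ASup F ε ⧸ idealI ε k

instance (k : ℕ) : AddCommGroup (AQuot F ε k) :=
  inferInstanceAs (AddCommGroup (ASup F ε ⧸ idealI ε k))
instance (k : ℕ) : Module F (AQuot F ε k) :=
  inferInstanceAs (Module F (ASup F ε ⧸ idealI ε k))

/-- The quotient map `A^(ε) → A^(ε) / I^(k)`. -/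
def toQuot (k : ℕ) : ASup F ε →ₗ[F] AQuot F ε k := (idealI ε k).mkQ

theorem toQuot_surjective (k : ℕ) : Function.Surjective (toQuot ε k) :=
  (idealI ε k).mkQ_surjective

theorem toQuot_eq_zero (k : ℕ) (a : ASup F ε) : toQuot ε k a = 0 ↔ a ∈ idealI ε k :=
  Submodule.Quotient.mk_eq_zero _

/-- The multiplication of `A^(ε) / I^(k)`, induced by that of `A^(ε)`. -/
def quotMul (k : ℕ) : AQuot F ε k →ₗ[F] AQuot F ε k →ₗ[F] AQuot F ε k :=
  (idealI ε k).liftQ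
    { toFun := fun a => (idealI ε k).liftQ ((toQuot ε k).comp (mulMap ε a)) fun b hb =>
        (toQuot_eq_zero ε k _).2 (idealI_mul_mem ε k a b hb).1
      map_add' := fun a b => by
        refine Submodule.linearMap_qext _ (LinearMap.ext fun c => ?_)
        change toQuot ε k (mulMap ε (a + b) c)
          = toQuot ε k (mulMap ε a c) + toQuot ε k (mulMap ε b c)
        rw [LinearMap.map_add₂, map_add]
      map_smul' := fun r a => by
        refine Submodule.linearMap_qext _ (LinearMap.ext fun c => ?_)
        change toQuot ε k (mulMap ε (r • a) c) = r • toQuot ε k (mulMap ε a c)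
        rw [LinearMap.map_smul₂, map_smul] }
    fun a ha => by
      refine LinearMap.mem_ker.2 (Submodule.linearMap_qext _ (LinearMap.ext fun c => ?_))
      exact (toQuot_eq_zero ε k _).2 (idealI_mul_mem ε k c a ha).2

instance (k : ℕ) : NonUnitalNonAssocRing (AQuot F ε k) where
  mul a b := quotMul ε k a b
  left_distrib a b c := (quotMul ε k a).map_add b c
  right_distrib a b c := (quotMul ε k).map_add₂ a b c
  zero_mul a := (quotMul ε k).map_zero₂ a
  mul_zero a := (quotMul ε k a).map_zero

instance (k : ℕ) : IsScalarTower F (AQuot F ε k) (AQuot F ε k) :=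
  ⟨fun c a b => (quotMul ε k).map_smul₂ c a b⟩

instance (k : ℕ) : SMulCommClass F (AQuot F ε k) (AQuot F ε k) :=
  ⟨fun c a b => ((quotMul ε k a).map_smul c b).symm⟩

theorem toQuot_mul (k : ℕ) (a b : ASup F ε) :
    toQuot ε k (a * b) = toQuot ε k a * toQuot ε k b := rfl

/-- The quotient superalgebra `A^(ε) / I^(k)`, with the grading induced from `A^(ε)`. -/
def quotSuper (k : ℕ) : Superalgebra F (AQuot F ε k) where
  part p := (aPart ε p).map (toQuot ε k)
  isCompl := by
    constructor
    · rw [Submodule.disjoint_def]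
      rintro _ ⟨u, hu, rfl⟩ ⟨v, hv, hvu⟩
      rw [toQuot_eq_zero]
      refine mem_idealI_of_sub ε k u v hu hv ?_
      rw [← toQuot_eq_zero, map_sub, hvu, sub_self]
    · rw [codisjoint_iff, ← Submodule.map_sup, aPart_sup, Submodule.map_top,
        LinearMap.range_eq_top]
      exact toQuot_surjective ε k
  mul_mem := by
    rintro p q _ _ ⟨a, ha, rfl⟩ ⟨b, hb, rfl⟩
    exact ⟨a * b, aPart_mul ε p q a b ha hb, toQuot_mul ε k a b⟩

end ASup

/-- The superalgebra `A^⟨n⟩`: `A^⟨2k⟩ = A^(0) / I^(k)` and `A^⟨2k+1⟩ = A^(1) / I^(k)`. -/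
def superA (F : Type u) [Field F] (n : ℕ) :
    Superalgebra F (AQuot F (if Even n then (0 : F) else 1) (n / 2)) :=
  quotSuper (if Even n then (0 : F) else 1) (n / 2)

end

end SuperRank

/-! The first two claims rest on one computation in the Grassmann envelope of `A^(ε)/I^(k)`. Its
elements are h⊗x + w with h odd and w in the span W of the g⊗a_{i,j}. Products of two elements lie
in W, and W·W = 0; this gives metabelianity and leaves only a few relations between x and the
a_{i,j} to check for right alternativity. Commuting twice with odd multiples of x turns g⊗a_{i,j}
into ghh'⊗a_{i+2,j} (`com_com_tmul`), whereas right multiplication by h⊗x raises only j. So 2k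
brackets kill W, and 2k+1 brackets kill every element (2k suffice if x² = 0): this is Lie-nilpotency
of step n, and it also gives φ_m = 0 for all m ≥ n. On the other hand φ_{n-1} takes a value
g⊗a_{i,j} with i < 2k and g a product of distinct generators (`exists_lift_phi`), and right
multiplications by x times fresh generators never make it vanish.

For the rank, let V(κ,m) ⊆ RL_n be given by φ_j R^{2κ_j} = 0 for m ≤ j < n. Adding φ_m R^{2N} = 0 to
V(κ,m+1), m ≥ 1, yields some V(κ',m). It is a proper subvariety, because the envelope of A^⟨m+1⟩
lies in V(κ,m+1) and violates the new identity. No new homogeneous identity of degree ≤ N appears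
(`isIdentity_of_isIdentity_union`): for A in V(κ,m+1), the algebra A⊗tF[t]/(t^{N+1}) satisfies the
old identities by multilinearity and the new one by degree, and its homogeneous identities of degree
≤ N hold in A. Hence V(κ,m+1) is a limit of such V(κ',m), and by induction V(κ,m) survives m-1
removals of isolated points. For m = n this variety is RL_n. -/

namespace SuperRank

open FreeNonUnitalNonAssocAlgebra (lift)
open scoped TensorProduct

noncomputable section

/-! ## Multilinear polynomials -/

/-- `f` is multilinear in the variables with indices in `s`. -/
inductive IsMultilinear {F : Type u} [Field F] : Finset ℕ → Poly F → Prop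
  | var (i : ℕ) : IsMultilinear {i} (x F i)
  | mul {s t : Finset ℕ} {f g : Poly F} (hst : Disjoint s t) (hf : IsMultilinear s f)
      (hg : IsMultilinear t g) : IsMultilinear (s ∪ t) (f * g)
  | add {s : Finset ℕ} {f g : Poly F} (hf : IsMultilinear s f) (hg : IsMultilinear s g) :
      IsMultilinear s (f + g)
  | sub {s : Finset ℕ} {f g : Poly F} (hf : IsMultilinear s f) (hg : IsMultilinear s g) :
      IsMultilinear s (f - g)

section

variable {F : Type u} [Field F] {A : Type u} [NonUnitalNonAssocRing A] [Module F A]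
  [IsScalarTower F A A] [SMulCommClass F A A]

@[simp]
theorem lift_x (v : ℕ → A) (i : ℕ) : lift F v (x F i) = v i :=
  FreeNonUnitalNonAssocAlgebra.lift_of_apply _ _ _

theorem IsMultilinear.com {s t : Finset ℕ} {f g : Poly F} (hst : Disjoint s t)
    (hf : IsMultilinear s f) (hg : IsMultilinear t g) : IsMultilinear (s ∪ t) (com f g) :=
  (hf.mul hst hg).sub (Finset.union_comm t s ▸ hg.mul hst.symm hf)

theorem IsMultilinear.lift_congr {s : Finset ℕ} {f : Poly F} (hf : IsMultilinear s f)
    {v w : ℕ → A} (h : ∀ i ∈ s, v i = w i) : lift F v f = lift F w f := by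
  induction hf with
  | var i => simpa using h i (by simp)
  | mul _ _ _ ihf ihg =>
    rw [map_mul, map_mul, ihf fun i hi => h i (Finset.mem_union_left _ hi),
      ihg fun i hi => h i (Finset.mem_union_right _ hi)]
  | add _ _ ihf ihg => rw [map_add, map_add, ihf h, ihg h]
  | sub _ _ ihf ihg => rw [map_sub, map_sub, ihf h, ihg h]

/-- In a product only one factor contains the variable `i`, by disjointness, and the other factor
acts as a fixed left or right multiplication. -/
theorem IsMultilinear.exists_linearMap {s : Finset ℕ} {f : Poly F} (hf : IsMultilinear s f)
    (v : ℕ → A) {i : ℕ} (hi : i ∈ s) :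
    ∃ L : A →ₗ[F] A, ∀ b, lift F (Function.update v i b) f = L b := by
  induction hf with
  | var j =>
    obtain rfl := Finset.mem_singleton.1 hi
    exact ⟨LinearMap.id, fun b => by simp⟩
  | @mul s t f g hst hf hg ihf ihg =>
    rcases Finset.mem_union.1 hi with hs | ht
    · obtain ⟨L, hL⟩ := ihf hs
      refine ⟨(LinearMap.mulRight F (lift F v g)).comp L, fun b => ?_⟩
      rw [map_mul, hL, hg.lift_congr (w := v) fun j hj => Function.update_of_ne
        (ne_of_mem_of_not_mem hj (Finset.disjoint_left.1 hst hs)) _ _]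
      rfl
    · obtain ⟨L, hL⟩ := ihg ht
      refine ⟨(LinearMap.mulLeft F (lift F v f)).comp L, fun b => ?_⟩
      rw [map_mul, hL, hf.lift_congr (w := v) fun j hj => Function.update_of_ne
        (ne_of_mem_of_not_mem hj (Finset.disjoint_right.1 hst ht)) _ _]
      rfl
  | add _ _ ihf ihg =>
    obtain ⟨L, hL⟩ := ihf hi
    obtain ⟨M, hM⟩ := ihg hi
    exact ⟨L + M, fun b => by rw [map_add, hL, hM]; rfl⟩
  | sub _ _ ihf ihg =>
    obtain ⟨L, hL⟩ := ihf hi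
    obtain ⟨M, hM⟩ := ihg hi
    exact ⟨L - M, fun b => by rw [map_sub, hL, hM]; rfl⟩

theorem IsMultilinear.lift_eq_zero {s : Finset ℕ} {f : Poly F} (hf : IsMultilinear s f)
    {v : ℕ → A} {i : ℕ} (hi : i ∈ s) (hv : v i = 0) : lift F v f = 0 := by
  obtain ⟨L, hL⟩ := hf.exists_linearMap v hi
  have h := hL 0
  rwa [map_zero, Function.update_eq_self_iff.2 hv.symm] at h

/-- A multilinear polynomial that vanishes on a spanning set is an identity. -/
theorem IsMultilinear.lift_eq_zero_of_span {s : Finset ℕ} {f : Poly F} (hf : IsMultilinear s f)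
    {B : Set A} (hB : Submodule.span F B = ⊤)
    (h : ∀ v : ℕ → A, (∀ i ∈ s, v i ∈ B) → lift F v f = 0) (v : ℕ → A) : lift F v f = 0 := by
  -- Induction on the set `t` of variables whose values are allowed to leave the spanning set `B`.
  suffices H : ∀ (t : Finset ℕ) (v : ℕ → A), (∀ i ∈ s, i ∉ t → v i ∈ B) → lift F v f = 0 from
    H s v fun i hi hi' => absurd hi hi'
  intro t
  induction t using Finset.induction_on with
  | empty => exact fun v hv => h v fun i hi => hv i hi (Finset.notMem_empty i)
  | insert a t _ ih =>
    intro v hv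
    by_cases ha : a ∈ s
    · obtain ⟨L, hL⟩ := hf.exists_linearMap v ha
      suffices hL0 : L = 0 by
        rw [← Function.update_eq_self a v, hL, hL0, LinearMap.zero_apply]
      refine LinearMap.ext_on hB fun b hb => ?_
      rw [← hL, LinearMap.zero_apply]
      refine ih _ fun i hi hit => ?_
      by_cases hia : i = a
      · subst hia; rwa [Function.update_self]
      · rw [Function.update_of_ne hia]
        exact hv i hi (by simp [hia, hit])
    · refine ih v fun i hi hit => hv i hi ?_
      have : i ≠ a := fun h => ha (h ▸ hi)
      simp [this, hit]

end

/-! ## Truncated polynomial extensions -/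

/-- The algebra `A ⊗ tF[t]/(t^{d+1})`; the component with index `k` is the coefficient of
`t^{k+1}`. -/
def Trunc (A : Type u) (d : ℕ) : Type u := Fin d → A

section Trunc

variable {F : Type u} [Field F] {A : Type u} {d : ℕ}

@[ext]
theorem Trunc.ext {a b : Trunc A d} (h : ∀ k, a k = b k) : a = b := funext h

variable [NonUnitalNonAssocRing A] [Module F A]

instance : AddCommGroup (Trunc A d) := inferInstanceAs (AddCommGroup (Fin d → A))
instance : Module F (Trunc A d) := inferInstanceAs (Module F (Fin d → A))

instance : Mul (Trunc A d) :=
  -- Index `i` stands for t^{i+1}, and t^{i+1}·t^{j+1} = t^{(i+j+1)+1}.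
  ⟨fun a b k => ∑ i : Fin d, ∑ j : Fin d, if (i + j + 1 : ℕ) = k then a i * b j else 0⟩

theorem Trunc.mul_apply (a b : Trunc A d) (k : Fin d) :
    (a * b) k = ∑ i : Fin d, ∑ j : Fin d, if (i + j + 1 : ℕ) = k then a i * b j else 0 := rfl

theorem Trunc.add_apply (a b : Trunc A d) (k : Fin d) : (a + b) k = a k + b k := rfl
theorem Trunc.zero_apply (k : Fin d) : (0 : Trunc A d) k = 0 := rfl
theorem Trunc.smul_apply (c : F) (a : Trunc A d) (k : Fin d) : (c • a) k = c • a k := rfl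

instance : NonUnitalNonAssocRing (Trunc A d) where
  left_distrib a b c := by
    ext k
    simp only [Trunc.mul_apply, Trunc.add_apply, ← Finset.sum_add_distrib]
    refine Finset.sum_congr rfl fun i _ => Finset.sum_congr rfl fun j _ => ?_
    split_ifs <;> simp [mul_add]
  right_distrib a b c := by
    ext k
    simp only [Trunc.mul_apply, Trunc.add_apply, ← Finset.sum_add_distrib]
    refine Finset.sum_congr rfl fun i _ => Finset.sum_congr rfl fun j _ => ?_
    split_ifs <;> simp [add_mul]
  zero_mul a := by ext k; simp [Trunc.mul_apply, Trunc.zero_apply]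
  mul_zero a := by ext k; simp [Trunc.mul_apply, Trunc.zero_apply]

instance [IsScalarTower F A A] : IsScalarTower F (Trunc A d) (Trunc A d) :=
  ⟨fun c a b => by
    ext k
    simp [Trunc.mul_apply, Trunc.smul_apply, Finset.smul_sum, smul_ite, smul_mul_assoc]⟩

instance [SMulCommClass F A A] : SMulCommClass F (Trunc A d) (Trunc A d) :=
  ⟨fun c a b => by
    ext k
    simp [Trunc.mul_apply, Trunc.smul_apply, Finset.smul_sum, smul_ite, mul_smul_comm]⟩

/-- The element `a t^w`. -/
def Trunc.mono (d w : ℕ) (a : A) : Trunc A d := fun k => if (k + 1 : ℕ) = w then a else 0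

theorem Trunc.mono_apply (w : ℕ) (a : A) (k : Fin d) :
    Trunc.mono d w a k = if (k + 1 : ℕ) = w then a else 0 := rfl

theorem Trunc.mono_add (w : ℕ) (a b : A) :
    Trunc.mono d w (a + b) = Trunc.mono d w a + Trunc.mono d w b := by
  ext k; simp only [Trunc.mono_apply, Trunc.add_apply]; split_ifs <;> simp

theorem Trunc.mono_smul (w : ℕ) (c : F) (a : A) :
    Trunc.mono d w (c • a) = c • Trunc.mono d w a := by
  ext k; simp only [Trunc.mono_apply, Trunc.smul_apply]; split_ifs <;> simp

/-- `Trunc.mono` as a linear map. -/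
def Trunc.monoHom (F : Type u) [Field F] [Module F A] (d w : ℕ) : A →ₗ[F] Trunc A d where
  toFun := Trunc.mono d w
  map_add' := Trunc.mono_add w
  map_smul' := Trunc.mono_smul w

theorem Trunc.mono_eq_zero {w : ℕ} (h : d < w) (a : A) : Trunc.mono d w a = 0 := by
  ext k; rw [Trunc.mono_apply, if_neg (by have := k.2; omega)]; rfl

/-- Weight 0 must be excluded: there are no constant terms, so `Trunc.mono d 0 a` is zero. -/
theorem Trunc.mono_mul {w w' : ℕ} (hw : 1 ≤ w) (hw' : 1 ≤ w') (a b : A) :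
    Trunc.mono d w a * Trunc.mono d w' b = Trunc.mono d (w + w') (a * b) := by
  ext k
  have hk := k.2
  simp only [Trunc.mul_apply, Trunc.mono_apply]
  by_cases h : (k + 1 : ℕ) = w + w'
  · rw [if_pos h, Finset.sum_eq_single ⟨w - 1, by omega⟩, Finset.sum_eq_single ⟨w' - 1, by omega⟩]
    · simp only
      rw [if_pos (by omega), if_pos (by omega), if_pos (by omega)]
    · intro j _ hj
      rw [if_neg fun hh => hj (Fin.ext (by simp only at hh ⊢; omega))]
    · simp
    · intro i _ hi
      refine Finset.sum_eq_zero fun j _ => ?_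
      rw [if_neg (c := (i + 1 : ℕ) = w) fun hh => hi (Fin.ext (by simp only at hh ⊢; omega)),
        zero_mul, ite_self]
    · simp
  · rw [if_neg h]
    refine Finset.sum_eq_zero fun i _ => Finset.sum_eq_zero fun j _ => ?_
    split_ifs <;> first | omega | simp

theorem Trunc.span_mono : Submodule.span F
    {t : Trunc A d | ∃ (w : ℕ) (a : A), 1 ≤ w ∧ t = Trunc.mono d w a} = ⊤ := by
  rw [eq_top_iff]
  intro t _
  have : t = ∑ k : Fin d, Trunc.mono d (k + 1) (t k) := by
    refine funext fun k => ?_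
    erw [Finset.sum_apply]
    rw [Finset.sum_eq_single k]
    · simp [Trunc.mono_apply]
    · intro j _ hj
      rw [Trunc.mono_apply, if_neg fun h => hj (Fin.ext (by omega))]
    · simp
  rw [this]
  exact Submodule.sum_mem _ fun k _ => Submodule.subset_span ⟨_, _, by omega, rfl⟩

variable [IsScalarTower F A A] [SMulCommClass F A A]

/-- Each variable occurs exactly once in every monomial, so the weights add up to the same total.
Positivity of that total is carried along because `Trunc.mono_mul` needs it. -/
theorem IsMultilinear.lift_mono {s : Finset ℕ} {f : Poly F} (hf : IsMultilinear s f)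
    (w : ℕ → ℕ) (v : ℕ → A) (hw : ∀ i ∈ s, 1 ≤ w i) :
    1 ≤ ∑ i ∈ s, w i ∧ lift F (fun i => Trunc.mono d (w i) (v i)) f =
      Trunc.mono d (∑ i ∈ s, w i) (lift F v f) := by
  induction hf with
  | var i => simpa using hw
  | mul hst _ _ ihf ihg =>
    obtain ⟨h1, h2⟩ := ihf fun i hi => hw i (Finset.mem_union_left _ hi)
    obtain ⟨h3, h4⟩ := ihg fun i hi => hw i (Finset.mem_union_right _ hi)
    rw [Finset.sum_union hst, map_mul, h2, h4, Trunc.mono_mul h1 h3, map_mul]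
    exact ⟨by omega, rfl⟩
  | add _ _ ihf ihg =>
    rw [map_add, (ihf hw).2, (ihg hw).2, map_add, Trunc.mono_add]
    exact ⟨(ihf hw).1, rfl⟩
  | sub _ _ ihf ihg =>
    rw [map_sub, (ihf hw).2, (ihg hw).2, map_sub]
    exact ⟨(ihf hw).1, ((Trunc.monoHom F d _).map_sub _ _).symm⟩

/-- By multilinearity it is enough to substitute monomials a t^w with w ≥ 1. The value is then a
value of `f` on `A` times a power of t of exponent at least `s.card`, so either the power or the
coefficient vanishes. -/
theorem IsMultilinear.trunc_eq_zero {s : Finset ℕ} {f : Poly F} (hf : IsMultilinear s f)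
    (h : d < s.card ∨ ∀ v : ℕ → A, lift F v f = 0) (v : ℕ → Trunc A d) : lift F v f = 0 := by
  refine hf.lift_eq_zero_of_span Trunc.span_mono (fun v hv => ?_) v
  choose! w a hw ha using hv
  rw [hf.lift_congr (w := fun i => Trunc.mono d (w i) (a i)) ha, (hf.lift_mono w a hw).2]
  rcases h with h | h
  · refine Trunc.mono_eq_zero (h.trans_le ?_) _
    simpa using Finset.card_nsmul_le_sum s w 1 hw
  · rw [h]
    exact (Trunc.monoHom F d _).map_zero

theorem lift_apply_eq (v : ℕ → A) (f : Poly F) :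
    lift F v f = f.coeff.sum fun m t => t • FreeMagma.lift v m := rfl

/-- All monomials of `f` have length `n`, so giving every variable weight 1 factors out t^n. -/
theorem IsHomogeneous.lift_mono {f : Poly F} {n : ℕ} (hf : IsHomogeneous f n) (v : ℕ → A) :
    lift F (fun i => Trunc.mono d 1 (v i)) f = Trunc.mono d n (lift F v f) := by
  have key : ∀ m : FreeMagma ℕ, FreeMagma.lift (fun i => Trunc.mono d 1 (v i)) m =
      Trunc.mono d m.length (FreeMagma.lift v m) := by
    intro m
    induction m using FreeMagma.recOnMul with
    | ih1 i => rfl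
    | ih2 a b iha ihb =>
      rw [map_mul, map_mul, iha, ihb, Trunc.mono_mul a.length_pos b.length_pos]
      rfl
  change _ = Trunc.monoHom F d n (lift F v f)
  rw [lift_apply_eq, lift_apply_eq, Finsupp.sum, Finsupp.sum, map_sum]
  refine Finset.sum_congr rfl fun m hm => ?_
  rw [map_smul, key, hf m hm]
  rfl

end Trunc

/-- Adding multilinear identities of degree more than `d` to a system of multilinear identities
gives no new homogeneous identities of degree at most `d`. -/
theorem isIdentity_of_isIdentity_union {F : Type u} [Field F] {S T : Set (Poly F)}
    (hS : ∀ f ∈ S, ∃ s, IsMultilinear s f) {d : ℕ}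
    (hT : ∀ f ∈ T, ∃ s, IsMultilinear s f ∧ d < s.card) {f : Poly F} {n : ℕ} (hn : n ≤ d)
    (hf : IsHomogeneous f n) (h : (Variety.ofIdentities (S ∪ T)).IsIdentity f) :
    (Variety.ofIdentities S).IsIdentity f := by
  intro A hA v
  rcases Nat.eq_zero_or_pos n with rfl | hpos
  -- Nonassociative monomials have positive length, so degree 0 leaves only the zero polynomial.
  · have h0 : f = 0 := by
      rw [← MonoidAlgebra.coeff_eq_zero, ← Finsupp.support_eq_empty, Finset.eq_empty_iff_forall_notMem]
      exact fun m hm => m.length_pos.ne' (hf m hm)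
    rw [h0, map_zero]
  · have hB : (⟨Trunc A.carrier d⟩ : Alg F) ∈ (Variety.ofIdentities (S ∪ T)).algs := by
      rintro g (hg | hg)
      · obtain ⟨s, hs⟩ := hS g hg
        exact hs.trunc_eq_zero (Or.inr (hA g hg))
      · obtain ⟨s, hs, hd⟩ := hT g hg
        exact hs.trunc_eq_zero (Or.inl hd)
    have h1 := h _ hB fun i => Trunc.mono d 1 (v i)
    rw [hf.lift_mono] at h1
    -- The coefficient of t^n has index n - 1; it exists because 1 ≤ n ≤ d.
    have h2 := congrFun h1 ⟨n - 1, by omega⟩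
    rwa [Trunc.mono_apply, if_pos (by simp only; omega)] at h2

/-! ## The topology on the set of subvarieties -/

section Topology

variable {F : Type u} [Field F] {V : Variety F}

theorem IsHomogeneous.degree_eq {f : Poly F} {n : ℕ} (hf : IsHomogeneous f n) (h0 : f ≠ 0) :
    degree f = n := by
  have hne : f.coeff.support.Nonempty := by
    rwa [Finsupp.support_nonempty_iff, Ne, MonoidAlgebra.coeff_eq_zero]
  unfold degree
  rw [Finset.sup_congr rfl hf, Finset.sup_const hne]

theorem le_dim_iff {V M : Variety F} {n : ℕ} :
    (n : ℕ∞) ≤ dim V M ↔ ∀ S, IsDistinguishing V M S → n ≤ S.sup degree := by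
  simp only [dim, le_iInf_iff, Nat.cast_le]

/-- Discarding the identities of `p` from a system distinguishing `M` from `R` leaves one that
distinguishes `M` from `p`, of no larger degree. So the dimension of `M` relative to `R` is at least
that relative to `p`. -/
theorem nbhd_subset_nbhd {n : ℕ} {p R : Subvarieties V} (h : p ∈ nbhd n R) :
    nbhd n p ⊆ nbhd n R := by
  classical
  rcases h with ⟨hlt, hdim⟩ | h
  · rintro M (⟨hM, hMd⟩ | hM)
    · refine Or.inl ⟨hM.trans hlt, le_dim_iff.2 fun S hS => ?_⟩
      refine (le_dim_iff.1 hMd (S.filter fun f => ¬ p.1.IsIdentity f) ⟨fun f hf => ?_, ?_⟩).trans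
        (Finset.sup_mono (Finset.filter_subset _ _))
      · rw [Finset.mem_filter] at hf
        exact ⟨(hS.1 f hf.1).1, hf.2⟩
      · ext A
        constructor
        · intro hA
          refine ⟨hM.le hA, fun f hf => ?_⟩
          rw [hS.2] at hA
          exact hA.2 f (Finset.mem_filter.1 hf).1
        · rintro ⟨hA, hA'⟩
          rw [hS.2]
          refine ⟨hlt.le hA, fun f hf => ?_⟩
          by_cases hfp : p.1.IsIdentity f
          · exact hfp A hA
          · exact hA' f (Finset.mem_filter.2 ⟨hf, hfp⟩)
    · obtain rfl := hM
      exact Or.inl ⟨hlt, hdim⟩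
  · obtain rfl := h
    exact subset_rfl

theorem nbhd_anti {m n : ℕ} (h : m ≤ n) (p : Subvarieties V) : nbhd n p ⊆ nbhd m p := by
  rintro M (⟨hM, hMd⟩ | hM)
  · exact Or.inl ⟨hM, le_trans (Nat.cast_le.2 h) hMd⟩
  · exact Or.inr hM

/-- The given sets only generate the topology; by `nbhd_subset_nbhd` and `nbhd_anti` the sets U_n(p)
are nevertheless cofinal among the open sets around `p`. -/
theorem exists_nbhd_subset {O : Set (Subvarieties V)} (hO : IsOpen O) {p : Subvarieties V}
    (hp : p ∈ O) : ∃ n, nbhd n p ⊆ O := by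
  induction hO with
  | basic O h =>
    obtain ⟨R, n, rfl⟩ := h
    exact ⟨n, nbhd_subset_nbhd hp⟩
  | univ => exact ⟨0, Set.subset_univ _⟩
  | inter s t _ _ hs ht =>
    obtain ⟨m, hm⟩ := hs hp.1
    obtain ⟨n, hn⟩ := ht hp.2
    exact ⟨max m n, Set.subset_inter ((nbhd_anti (le_max_left _ _) p).trans hm)
      ((nbhd_anti (le_max_right _ _) p).trans hn)⟩
  | sUnion S _ ih =>
    obtain ⟨s, hs, hps⟩ := hp
    obtain ⟨n, hn⟩ := ih s hs hps
    exact ⟨n, hn.trans (Set.subset_sUnion_of_mem hs)⟩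

/-- A point of `Ω` is not isolated if it is approximated by proper subvarieties in `Ω` having the
same identities of low degree. -/
theorem mem_derived {Ω : Set (Subvarieties V)} {p : Subvarieties V} (hp : p ∈ Ω)
    (h : ∀ n : ℕ, ∃ M ∈ Ω, M.1 < p.1 ∧ ∀ (f : Poly F) (d : ℕ), d ≤ n → IsHomogeneous f d →
      M.1.IsIdentity f → p.1.IsIdentity f) : p ∈ derived Ω := by
  refine ⟨hp, ?_⟩
  rintro ⟨O, hO, hOp⟩
  have hpO : p ∈ O := (hOp.ge (Set.mem_singleton p)).1
  obtain ⟨n, hn⟩ := exists_nbhd_subset hO hpO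
  obtain ⟨M, hM, hlt, hid⟩ := h n
  have hMO : M ∈ O := by
    refine hn (Or.inl ⟨hlt, le_dim_iff.2 fun S hS => ?_⟩)
    -- A distinguishing system of degree below `n` would consist of identities of `M` of low degree,
    -- hence of identities of `p`. None is allowed in the system, so it would be empty and `M` would
    -- equal `p`.
    by_contra! hlow
    refine hlt.not_ge fun A hA => ?_
    rw [hS.2]
    refine ⟨hA, fun f hf => ?_⟩
    obtain ⟨⟨d, hd⟩, hfp⟩ := hS.1 f hf
    have hf0 : f ≠ 0 := by
      rintro rfl
      exact hfp fun A _ v => map_zero _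
    have hdn : d ≤ n := (hd.degree_eq hf0).symm.trans_le ((Finset.le_sup hf).trans hlow.le)
    refine absurd (hid f d hdn hd fun B hB => ?_) hfp
    rw [hS.2] at hB
    exact hB.2 f hf
  have : M = p := hOp.le ⟨hMO, hM⟩
  exact hlt.ne (congrArg Subtype.val this)

theorem le_topRankSet {X : Type*} [TopologicalSpace X] {Ω : Set X} {n : ℕ}
    (h : ∀ m < n, (derived^[m] Ω).Nonempty) : (n : ℕ∞) ≤ topRankSet Ω := by
  simp only [topRankSet, le_iInf_iff, Nat.cast_le]
  intro m hm
  by_contra! hlt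
  exact (h m hlt).ne_empty hm

end Topology

/-! ## Signs in the Grassmann algebra -/

section Grassmann

variable {F : Type u} [Field F]

theorem ι_mul_eq_involute_mul (m : ℕ →₀ F) (g : Grassmann F) :
    ExteriorAlgebra.ι F m * g = CliffordAlgebra.involute g * ExteriorAlgebra.ι F m := by
  induction g using ExteriorAlgebra.induction with
  | algebraMap r => rw [AlgHom.commutes]; exact (Algebra.commutes r _).symm
  | ι y =>
    rw [eq_neg_of_add_eq_zero_left (ExteriorAlgebra.ι_add_mul_swap m y), ← neg_mul]
    exact congrArg (· * _) (CliffordAlgebra.involute_ι y).symm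
  | mul a b ha hb => rw [map_mul, ← mul_assoc, ha, mul_assoc, hb, mul_assoc]
  | add a b ha hb => rw [map_add, mul_add, add_mul, ha, hb]

theorem odd_mul_comm {n : ℕ} {g h : Grassmann F} (hg : g ∈ grassmannPart F (n : ZMod 2))
    (hh : h ∈ grassmannPart F 1) : h * g = (-1 : F) ^ n • (g * h) := by
  have hι : ∀ m, ExteriorAlgebra.ι F m * g = (-1 : F) ^ n • (g * ExteriorAlgebra.ι F m) := by
    intro m
    rw [ι_mul_eq_involute_mul]
    rcases Nat.even_or_odd n with hn | hn
    · rw [(ZMod.natCast_eq_zero_iff_even).2 hn] at hg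
      rw [CliffordAlgebra.involute_eq_of_mem_even hg, hn.neg_one_pow, one_smul]
    · rw [(ZMod.natCast_eq_one_iff_odd).2 hn] at hg
      rw [CliffordAlgebra.involute_eq_of_mem_odd hg, hn.neg_one_pow, neg_smul, one_smul, neg_mul]
  unfold grassmannPart at hh
  induction h, hh using CliffordAlgebra.odd_induction with
  | ι v => exact hι v
  | add x y hx hy hx' hy' => rw [add_mul, hx', hy', mul_add, smul_add]
  | ι_mul_ι_mul m₁ m₂ y hy ih =>
    have h1 := hι m₁
    have h2 := hι m₂
    unfold ExteriorAlgebra.ι at h1 h2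
    -- Passing the two extra generators through `g` costs the sign (-1)^n twice, which cancels.
    rw [mul_assoc, ih, mul_smul_comm, mul_assoc, ← mul_assoc _ g, h2, smul_mul_assoc,
      mul_smul_comm, mul_assoc, ← mul_assoc _ g, h1, smul_mul_assoc, smul_smul, smul_smul,
      ← pow_add, (Even.add_self n).neg_one_pow, one_mul]
    simp only [mul_assoc]

theorem odd_mul_odd {g h : Grassmann F} (hg : g ∈ grassmannPart F 1)
    (hh : h ∈ grassmannPart F 1) : h * g = -(g * h) := by
  have := odd_mul_comm (n := 1) (by simpa using hg) hh
  simpa using this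

theorem grassmannPart_mul {p q : ZMod 2} {g h : Grassmann F} (hg : g ∈ grassmannPart F p)
    (hh : h ∈ grassmannPart F q) : g * h ∈ grassmannPart F (p + q) :=
  CliffordAlgebra.evenOdd_mul_le _ p q (Submodule.mul_mem_mul hg hh)

/-- The generator with a given index. -/
def gen (F : Type u) [Field F] (i : ℕ) : Grassmann F := ExteriorAlgebra.ι F (Finsupp.single i 1)

theorem gen_mem (i : ℕ) : gen F i ∈ grassmannPart F 1 :=
  CliffordAlgebra.ι_mem_evenOdd_one _ _

theorem one_mem_grassmannPart : (1 : Grassmann F) ∈ grassmannPart F 0 :=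
  Submodule.one_le.1 (CliffordAlgebra.one_le_evenOdd_zero _)

/-- The product of a list of generators. -/
def genProd (F : Type u) [Field F] (l : List ℕ) : Grassmann F := (l.map (gen F)).prod

theorem genProd_append (l m : List ℕ) : genProd F (l ++ m) = genProd F l * genProd F m := by
  simp [genProd]

theorem genProd_singleton (i : ℕ) : genProd F [i] = gen F i := by
  simp [genProd]

theorem genProd_mem (l : List ℕ) : genProd F l ∈ grassmannPart F (l.length : ZMod 2) := by
  induction l with
  | nil => simpa [genProd] using one_mem_grassmannPart
  | cons a l ih =>
    have := grassmannPart_mul (gen_mem (F := F) a) ih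
    rw [List.length_cons, Nat.cast_succ, add_comm]
    simpa [genProd] using this

/-- The functional is the determinant of the coordinates listed in `l`: on the generators of `l`
themselves the matrix is the identity, because `l` has no repetitions. -/
theorem exists_dual_genProd {l : List ℕ} (hl : l.Nodup) :
    ∃ φ : Grassmann F →ₗ[F] F, φ (genProd F l) = 1 := by
  -- A form is required in every degree. Only degree `l.length` matters, and there the default value
  -- of `getD` is never used.
  let f : ∀ m : ℕ, (ℕ →₀ F) [⋀^Fin m]→ₗ[F] F := fun m =>
    (Matrix.detRowAlternating (R := F) (n := Fin m)).compLinearMap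
      (LinearMap.pi fun c => Finsupp.lapply (l.getD c 0))
  refine ⟨ExteriorAlgebra.liftAlternating f, ?_⟩
  have h : genProd F l =
      ExteriorAlgebra.ιMulti F l.length fun c => Finsupp.single (l.get c) (1 : F) := by
    rw [ExteriorAlgebra.ιMulti_apply, genProd]
    congr 1
    exact List.ext_get (by simp) (by simp [gen])
  rw [h, ExteriorAlgebra.liftAlternating_apply_ιMulti]
  change Matrix.det _ = 1
  refine (congrArg Matrix.det (Matrix.ext fun r c => ?_)).trans Matrix.det_one
  have hc : l.getD c 0 = l.get c := by simp
  simp only [Matrix.one_apply, LinearMap.pi_apply, Finsupp.lapply_apply, hc, Finsupp.single_apply,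
    hl.injective_get.eq_iff]

theorem genProd_tmul_eq_zero {l : List ℕ} (hl : l.Nodup) {M : Type*} [AddCommGroup M] [Module F M]
    {a : M} (h : genProd F l ⊗ₜ[F] a = 0) : a = 0 := by
  obtain ⟨φ, hφ⟩ := exists_dual_genProd (F := F) hl
  have := congrArg (fun t => TensorProduct.lid F M (φ.rTensor M t)) h
  simpa [hφ] using this

end Grassmann

/-! ## Products in the quotients of `A^(ε)` -/

section Quotient

variable {F : Type u} [Field F] (ε : F) (k : ℕ)

/-- The image of `x`. -/
def qx : AQuot F ε k := toQuot ε k (bas ε .x)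

/-- The image of `a_{i,j}`. -/
def qa (i j : ℕ) : AQuot F ε k := toQuot ε k (bas ε (.a i j))

theorem qx_mul_qx : qx ε k * qx ε k = (ε / 2) • qa ε k 0 0 := by
  rw [qx, ← toQuot_mul, bas_mul_bas]; exact map_smul _ _ _

theorem qa_mul_qx (i j : ℕ) : qa ε k i j * qx ε k = qa ε k i (j + 1) := by
  rw [qx, qa, ← toQuot_mul, bas_mul_bas]; rfl

theorem qa_mul_qa (i j i' j' : ℕ) : qa ε k i j * qa ε k i' j' = 0 := by
  rw [qa, qa, ← toQuot_mul, bas_mul_bas]; exact map_zero _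

theorem qx_mul_qa_even (i j : ℕ) : qx ε k * qa ε k i (2 * j) =
    (-1 : F) ^ i • (qa ε k i (2 * j + 1) - qa ε k (i + 1) (2 * j)) := by
  rw [qx, qa, ← toQuot_mul, bas_mul_bas, basMul, if_pos (even_two_mul j), map_smul, map_sub]
  rfl

theorem qx_mul_qa_odd (i j : ℕ) : qx ε k * qa ε k i (2 * j + 1) =
    ((-1 : F) ^ i / 2) • (qa ε k i (2 * j + 2) - (2 : F) • qa ε k (i + 1) (2 * j + 1)
      + qa ε k (i + 2) (2 * j)) := by
  rw [qx, qa, ← toQuot_mul, bas_mul_bas, basMul, if_neg (by simp), map_smul, map_add, map_sub,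
    map_smul]
  rfl

theorem qa_eq_zero {i j : ℕ} (h : 2 * k ≤ i) : qa ε k i j = 0 :=
  (toQuot_eq_zero ε k _).2 (Submodule.subset_span ⟨i, j, h, rfl⟩)

theorem qa_ne_zero {i j : ℕ} (h : i < 2 * k) : qa ε k i j ≠ 0 := by
  intro h0
  rw [qa, toQuot_eq_zero, idealI_eq, bas] at h0
  have := (Finsupp.mem_supported' F _).1 h0 (.a i j) (by
    rintro ⟨i', j', h', he⟩
    cases he
    omega)
  rw [Finsupp.single_eq_same] at this
  exact one_ne_zero this

variable (h2 : (2 : F) ≠ 0)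
include h2

/-- This is right alternativity for h⊗x, g⊗a_{i,j}, h'⊗x with the Grassmann factors removed. The
term x²·a_{i,j} is absent because the a's annihilate each other, and the sign comes from moving h'
past g. -/
theorem super_rightAlt (i j : ℕ) : qx ε k * qa ε k i j * qx ε k - qx ε k * (qa ε k i j * qx ε k) -
    (-1 : F) ^ (i + j) • (qx ε k * (qx ε k * qa ε k i j)) = 0 := by
  obtain ⟨j, rfl | rfl⟩ := Nat.even_or_odd' j
  · have e := qx_mul_qa_odd ε k i j
    rw [qa_mul_qx, e, qx_mul_qa_even, smul_mul_assoc, sub_mul, qa_mul_qx, qa_mul_qx,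
      mul_smul_comm, mul_sub, e, qx_mul_qa_even, pow_add, pow_mul]
    rcases neg_one_pow_eq_or F i with h | h <;> simp only [h, pow_succ] <;>
      match_scalars <;> field_simp <;> ring
  · have e := qx_mul_qa_even ε k i (j + 1)
    rw [show 2 * (j + 1) = 2 * j + 2 by ring] at e
    rw [qa_mul_qx, show 2 * j + 1 + 1 = 2 * j + 2 by ring, e, qx_mul_qa_odd, smul_mul_assoc,
      add_mul, sub_mul, smul_mul_assoc, qa_mul_qx, qa_mul_qx, qa_mul_qx, mul_smul_comm, mul_add,
      mul_sub, mul_smul_comm, e, qx_mul_qa_odd, qx_mul_qa_even, pow_add, pow_succ _ (2 * j),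
      pow_mul]
    rcases neg_one_pow_eq_or F i with h | h <;> simp only [h, pow_succ] <;>
      match_scalars <;> field_simp <;> ring

end Quotient

theorem map_lift {F : Type u} [Field F] {A B : Type u} [NonUnitalNonAssocRing A] [Module F A]
    [IsScalarTower F A A] [SMulCommClass F A A] [NonUnitalNonAssocRing B] [Module F B]
    [IsScalarTower F B B] [SMulCommClass F B B] (φ : A →ₙₐ[F] B) (v : ℕ → A) (f : Poly F) :
    φ (lift F v f) = lift F (fun i => φ (v i)) f := by
  change (φ.comp (lift F v)) f = _
  congr 1
  refine FreeNonUnitalNonAssocAlgebra.hom_ext F fun i => ?_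
  simp

/-! ## Left-normed commutators -/

section Commutators

variable {A : Type u} [NonUnitalNonAssocRing A]

theorem leftCom_succ (a : A) (v : ℕ → A) (m : ℕ) :
    leftCom a v (m + 1) = com (leftCom a v m) (v m) := rfl

theorem leftCom_succ' (a : A) (v : ℕ → A) (m : ℕ) :
    leftCom a v (m + 1) = leftCom (com a (v 0)) (fun i => v (i + 1)) m := by
  induction m with
  | zero => rfl
  | succ m ih => rw [leftCom_succ, ih, leftCom_succ]

theorem com_sub (a b c : A) : com (a - b) c = com a c - com b c := by
  simp only [com, sub_mul, mul_sub]; abel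

theorem leftCom_sub (a b : A) (v : ℕ → A) (m : ℕ) :
    leftCom (a - b) v m = leftCom a v m - leftCom b v m := by
  induction m with
  | zero => rfl
  | succ m ih => rw [leftCom_succ, ih, com_sub, leftCom_succ, leftCom_succ]

theorem leftCom_eq_zero_of_le {a : A} {v : ℕ → A} {m n : ℕ} (h : m ≤ n)
    (h0 : leftCom a v m = 0) : leftCom a v n = 0 := by
  induction n, h using Nat.le_induction with
  | base => exact h0
  | succ n _ ih => rw [leftCom_succ, ih, com, zero_mul, mul_zero, sub_zero]

variable {F : Type u} [Field F] [Module F A] [IsScalarTower F A A] [SMulCommClass F A A]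

theorem lift_leftCom (v : ℕ → A) (f : Poly F) (w : ℕ → Poly F) (m : ℕ) :
    lift F v (leftCom f w m) = leftCom (lift F v f) (fun i => lift F v (w i)) m := by
  induction m with
  | zero => rfl
  | succ m ih => simp only [leftCom_succ, com, map_sub, map_mul, ih]

theorem lift_phi (v : ℕ → A) (n : ℕ) : lift F v (phi F n) =
    if Even n then leftCom (v 0) (fun i => v (i + 1)) n
    else leftCom (v 0 * v 1) (fun i => v (i + 2)) (n - 1) := by
  unfold phi
  split_ifs <;> simp only [lift_leftCom, map_mul, lift_x]

theorem lift_lieNil (v : ℕ → A) (s : ℕ) : lift F v (lieNil F s) =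
    leftCom (v 0) (fun i => v (i + 1)) s := by
  simp only [lieNil, lift_leftCom, lift_x]

theorem lift_rightMul (v : ℕ → A) (f : Poly F) {m : ℕ} (j : Fin m → ℕ) :
    lift F v (rightMul f j) = (List.ofFn j).foldl (fun g i => g * v i) (lift F v f) := by
  unfold rightMul
  generalize List.ofFn j = l
  induction l generalizing f with
  | nil => rfl
  | cons a l ih => rw [List.foldl_cons, List.foldl_cons, ih, map_mul, lift_x]

end Commutators

/-! ## Products in the Grassmann envelope -/

section Envelope

variable {F : Type u} [Field F] (ε : F) (k : ℕ)

/-- The span of all `g ⊗ a_{i,j}` with `i ≥ p` in the Grassmann envelope. -/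
def envA (p : ℕ) : Submodule F (Grassmann F ⊗[F] AQuot F ε k) :=
  Submodule.span F {t | ∃ (i j : ℕ) (g : Grassmann F), p ≤ i ∧
    g ∈ grassmannPart F ((i + j : ℕ) : ZMod 2) ∧ t = g ⊗ₜ[F] qa ε k i j}

variable {ε k}

theorem tmul_qa_mem {p i j : ℕ} {g : Grassmann F} (hi : p ≤ i)
    (hg : g ∈ grassmannPart F ((i + j : ℕ) : ZMod 2)) : g ⊗ₜ[F] qa ε k i j ∈ envA ε k p :=
  Submodule.subset_span ⟨i, j, g, hi, hg, rfl⟩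

theorem envA_anti {p q : ℕ} (h : p ≤ q) : envA ε k q ≤ envA ε k p := by
  refine Submodule.span_mono ?_
  rintro _ ⟨i, j, g, hi, hg, rfl⟩
  exact ⟨i, j, g, h.trans hi, hg, rfl⟩

theorem eq_zero_of_mem_envA {p : ℕ} (hp : 2 * k ≤ p) {w : Grassmann F ⊗[F] AQuot F ε k}
    (hw : w ∈ envA ε k p) : w = 0 := by
  unfold envA at hw
  induction hw using Submodule.span_induction with
  | zero => rfl
  | add a b _ _ ha hb => rw [ha, hb, add_zero]
  | smul c a _ ha => rw [ha, smul_zero]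
  | mem t ht =>
    obtain ⟨i, j, g, hi, _, rfl⟩ := ht
    rw [qa_eq_zero ε k (hp.trans hi), TensorProduct.tmul_zero]

theorem envA_mul_envA {w w' : Grassmann F ⊗[F] AQuot F ε k} (hw : w ∈ envA ε k 0)
    (hw' : w' ∈ envA ε k 0) : w * w' = 0 := by
  unfold envA at hw hw'
  induction hw using Submodule.span_induction with
  | zero => rw [zero_mul]
  | add a b _ _ ha hb => rw [add_mul, ha, hb, add_zero]
  | smul c a _ ha => rw [smul_mul_assoc, ha, smul_zero]
  | mem t ht =>
    obtain ⟨i, j, g, hi, _, rfl⟩ := ht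
    induction hw' using Submodule.span_induction with
    | zero => rw [mul_zero]
    | add a b _ _ ha hb => rw [mul_add, ha, hb, add_zero]
    | smul c a _ ha => rw [mul_smul_comm, ha, smul_zero]
    | mem t ht =>
      obtain ⟨i, j, g, hi, _, rfl⟩ := ht
      rw [Algebra.TensorProduct.tmul_mul_tmul, qa_mul_qa, TensorProduct.tmul_zero]

/-- The element `h ⊗ x`. -/
def ex (ε : F) (k : ℕ) (h : Grassmann F) : Grassmann F ⊗[F] AQuot F ε k := h ⊗ₜ[F] qx ε k

theorem tmul_mul_ex (g h : Grassmann F) (i j : ℕ) :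
    g ⊗ₜ[F] qa ε k i j * ex ε k h = (g * h) ⊗ₜ[F] qa ε k i (j + 1) := by
  rw [ex, Algebra.TensorProduct.tmul_mul_tmul, qa_mul_qx]

theorem ex_mul_ex (g h : Grassmann F) :
    ex ε k g * ex ε k h = (ε / 2) • (g * h) ⊗ₜ[F] qa ε k 0 0 := by
  rw [ex, ex, Algebra.TensorProduct.tmul_mul_tmul, qx_mul_qx, TensorProduct.tmul_smul]

theorem odd_mul_mem {n : ℕ} {g h : Grassmann F} (hg : g ∈ grassmannPart F (n : ZMod 2))
    (hh : h ∈ grassmannPart F 1) : g * h ∈ grassmannPart F ((n + 1 : ℕ) : ZMod 2) := by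
  simpa using grassmannPart_mul hg hh

theorem grassmannPart_congr {m n : ℕ} (h : Even m ↔ Even n) {g : Grassmann F}
    (hg : g ∈ grassmannPart F (m : ZMod 2)) : g ∈ grassmannPart F (n : ZMod 2) := by
  rcases Nat.even_or_odd n with hn | hn
  · rwa [ZMod.natCast_eq_zero_iff_even.2 hn, ← ZMod.natCast_eq_zero_iff_even.2 (h.2 hn)]
  · rw [← Nat.not_even_iff_odd, ← h, Nat.not_even_iff_odd] at hn
    rw [ZMod.natCast_eq_one_iff_odd.2 hn] at hg
    rwa [ZMod.natCast_eq_one_iff_odd.2]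
    rwa [← Nat.not_even_iff_odd, ← h, Nat.not_even_iff_odd]

theorem ex_mul_ex_mem {g h : Grassmann F} (hg : g ∈ grassmannPart F 1)
    (hh : h ∈ grassmannPart F 1) : ex ε k g * ex ε k h ∈ envA ε k 0 := by
  rw [ex_mul_ex]
  exact Submodule.smul_mem _ _ (tmul_qa_mem (Nat.zero_le _)
    (by rw [show ((0 + 0 : ℕ) : ZMod 2) = 1 + 1 from rfl]; exact grassmannPart_mul hg hh))

theorem envA_mul_ex {p : ℕ} {w : Grassmann F ⊗[F] AQuot F ε k} (hw : w ∈ envA ε k p)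
    {h : Grassmann F} (hh : h ∈ grassmannPart F 1) : w * ex ε k h ∈ envA ε k p := by
  unfold envA at hw
  induction hw using Submodule.span_induction with
  | zero => rw [zero_mul]; exact zero_mem _
  | add a b _ _ ha hb => rw [add_mul]; exact add_mem ha hb
  | smul c a _ ha => rw [smul_mul_assoc]; exact Submodule.smul_mem _ _ ha
  | mem t ht =>
    obtain ⟨i, j, g, hi, hg, rfl⟩ := ht
    rw [tmul_mul_ex]
    exact tmul_qa_mem hi (odd_mul_mem hg hh)

theorem ex_mul_tmul {i j : ℕ} {g h : Grassmann F}
    (hg : g ∈ grassmannPart F ((i + j : ℕ) : ZMod 2)) (hh : h ∈ grassmannPart F 1) :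
    ex ε k h * g ⊗ₜ[F] qa ε k i j =
      (g * h) ⊗ₜ[F] ((-1 : F) ^ (i + j) • (qx ε k * qa ε k i j)) := by
  rw [ex, Algebra.TensorProduct.tmul_mul_tmul, odd_mul_comm hg hh, TensorProduct.smul_tmul]

theorem com_tmul_even {i j : ℕ} {g h : Grassmann F}
    (hg : g ∈ grassmannPart F ((i + 2 * j : ℕ) : ZMod 2)) (hh : h ∈ grassmannPart F 1) :
    com (g ⊗ₜ[F] qa ε k i (2 * j)) (ex ε k h) = (g * h) ⊗ₜ[F] qa ε k (i + 1) (2 * j) := by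
  rw [com, tmul_mul_ex, ex_mul_tmul hg hh, ← TensorProduct.tmul_sub, qx_mul_qa_even, pow_add,
    pow_mul]
  congr 1
  rcases neg_one_pow_eq_or F i with h | h <;> simp only [h, even_two.neg_one_pow, one_pow] <;>
    module

variable (h2 : (2 : F) ≠ 0)

include h2 in
theorem com_tmul_odd {i j : ℕ} {g h : Grassmann F}
    (hg : g ∈ grassmannPart F ((i + (2 * j + 1) : ℕ) : ZMod 2)) (hh : h ∈ grassmannPart F 1) :
    com (g ⊗ₜ[F] qa ε k i (2 * j + 1)) (ex ε k h) =
      (3 / 2 : F) • (g * h) ⊗ₜ[F] qa ε k i (2 * (j + 1)) -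
        (g * h) ⊗ₜ[F] qa ε k (i + 1) (2 * j + 1) +
        (1 / 2 : F) • (g * h) ⊗ₜ[F] qa ε k (i + 2) (2 * j) := by
  rw [com, tmul_mul_ex, ex_mul_tmul hg hh, ← TensorProduct.tmul_sub, qx_mul_qa_odd, pow_add,
    pow_succ _ (2 * j), pow_mul, ← TensorProduct.tmul_smul, ← TensorProduct.tmul_smul,
    ← TensorProduct.tmul_sub, ← TensorProduct.tmul_add]
  congr 1
  rw [show 2 * (j + 1) = 2 * j + 2 by ring]
  rcases neg_one_pow_eq_or F i with h | h <;> simp only [h, even_two.neg_one_pow, one_pow] <;>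
    match_scalars <;> field_simp <;> ring

include h2 in
/-- Two commutations with odd multiples of `x` shift the first index by two. -/
theorem com_com_tmul {i j : ℕ} {g h h' : Grassmann F}
    (hg : g ∈ grassmannPart F ((i + j : ℕ) : ZMod 2)) (hh : h ∈ grassmannPart F 1)
    (hh' : h' ∈ grassmannPart F 1) :
    com (com (g ⊗ₜ[F] qa ε k i j) (ex ε k h)) (ex ε k h') =
      (g * h * h') ⊗ₜ[F] qa ε k (i + 2) j := by
  have hgh := odd_mul_mem hg hh
  obtain ⟨j, rfl | rfl⟩ := Nat.even_or_odd' j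
  · rw [com_tmul_even hg hh, com_tmul_even (grassmannPart_congr (by simp only [Nat.even_iff]; omega) hgh) hh']
  · have com_lin : ∀ (a b c : F) (u v w z : Grassmann F ⊗[F] AQuot F ε k),
        com (a • u - v + c • w) z = a • com u z - com v z + c • com w z := by
      intro a b c u v w z
      simp only [com, add_mul, sub_mul, mul_add, mul_sub, smul_mul_assoc, mul_smul_comm]
      module
    have e : ∀ i' j' : ℕ, (Even (i' + j') ↔ Even (i + (2 * j + 1) + 1)) →
        g * h ∈ grassmannPart F ((i' + j' : ℕ) : ZMod 2) :=
      fun i' j' hij => grassmannPart_congr hij.symm hgh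
    -- For odd second index the first bracket has three terms. After the second bracket the terms
    -- 3/2·a_{i+1,2j+2} cancel, as do the terms 1/2·a_{i+3,2j}, leaving only a_{i+2,2j+1}.
    rw [com_tmul_odd h2 hg hh, com_lin _ 0,
      com_tmul_even (e _ _ (by simp only [Nat.even_iff]; omega)) hh',
      com_tmul_odd h2 (e _ _ (by simp only [Nat.even_iff]; omega)) hh',
      com_tmul_even (e _ _ (by simp only [Nat.even_iff]; omega)) hh']
    match_scalars <;> field_simp <;> ring

theorem ex_mul_envA {w : Grassmann F ⊗[F] AQuot F ε k} (hw : w ∈ envA ε k 0)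
    {h : Grassmann F} (hh : h ∈ grassmannPart F 1) : ex ε k h * w ∈ envA ε k 0 := by
  unfold envA at hw
  induction hw using Submodule.span_induction with
  | zero => rw [mul_zero]; exact zero_mem _
  | add a b _ _ ha hb => rw [mul_add]; exact add_mem ha hb
  | smul c a _ ha => rw [mul_smul_comm]; exact Submodule.smul_mem _ _ ha
  | mem t ht =>
    obtain ⟨i, j, g, hi, hg, rfl⟩ := ht
    have hgh := odd_mul_mem hg hh
    have e : ∀ i' j' : ℕ, (Even (i' + j') ↔ Even (i + j + 1)) →
        (g * h) ⊗ₜ[F] qa ε k i' j' ∈ envA ε k 0 :=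
      fun i' j' hij => tmul_qa_mem (Nat.zero_le _) (grassmannPart_congr hij.symm hgh)
    rw [ex_mul_tmul hg hh, TensorProduct.tmul_smul]
    refine Submodule.smul_mem _ _ ?_
    obtain ⟨j, rfl | rfl⟩ := Nat.even_or_odd' j
    · rw [qx_mul_qa_even, TensorProduct.tmul_smul, TensorProduct.tmul_sub]
      exact Submodule.smul_mem _ _ (sub_mem (e _ _ (by simp only [Nat.even_iff]; omega))
        (e _ _ (by simp only [Nat.even_iff]; omega)))
    · rw [qx_mul_qa_odd, TensorProduct.tmul_smul, TensorProduct.tmul_add, TensorProduct.tmul_sub,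
        TensorProduct.tmul_smul]
      exact Submodule.smul_mem _ _ (add_mem (sub_mem (e _ _ (by simp only [Nat.even_iff]; omega))
        (Submodule.smul_mem _ _ (e _ _ (by simp only [Nat.even_iff]; omega))))
        (e _ _ (by simp only [Nat.even_iff]; omega)))

theorem com_mem_envA {w : Grassmann F ⊗[F] AQuot F ε k} (hw : w ∈ envA ε k 0)
    {h : Grassmann F} (hh : h ∈ grassmannPart F 1) : com w (ex ε k h) ∈ envA ε k 0 :=
  sub_mem (envA_mul_ex hw hh) (ex_mul_envA hw hh)

include h2 in
theorem com_com_mem_envA {p : ℕ} {w : Grassmann F ⊗[F] AQuot F ε k} (hw : w ∈ envA ε k p)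
    {h h' : Grassmann F} (hh : h ∈ grassmannPart F 1) (hh' : h' ∈ grassmannPart F 1) :
    com (com w (ex ε k h)) (ex ε k h') ∈ envA ε k (p + 2) := by
  unfold envA at hw
  induction hw using Submodule.span_induction with
  | zero => simp only [com, zero_mul, mul_zero, sub_zero, zero_mem]
  | add a b _ _ ha hb =>
    convert add_mem ha hb using 1
    simp only [com, add_mul, mul_add, sub_mul, mul_sub]
    abel
  | smul c a _ ha =>
    convert Submodule.smul_mem _ c ha using 1
    simp only [com, smul_mul_assoc, mul_smul_comm, sub_mul, mul_sub, smul_sub]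
  | mem t ht =>
    obtain ⟨i, j, g, hi, hg, rfl⟩ := ht
    rw [com_com_tmul h2 hg hh hh']
    exact tmul_qa_mem (by omega) (by
      convert odd_mul_mem (odd_mul_mem hg hh) hh' using 2
      push_cast
      ring)

variable (ε k) in
/-- Elements of the form `h ⊗ x + w` with `h` odd and `w` in the span of the `g ⊗ a_{i,j}`. -/
def IsElt (u : Grassmann F ⊗[F] AQuot F ε k) : Prop :=
  ∃ h ∈ grassmannPart F 1, ∃ w ∈ envA ε k 0, u = ex ε k h + w

theorem isElt_of_mem {w : Grassmann F ⊗[F] AQuot F ε k} (hw : w ∈ envA ε k 0) : IsElt ε k w :=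
  ⟨0, zero_mem _, w, hw, by rw [ex, TensorProduct.zero_tmul, zero_add]⟩

theorem IsElt.add {u v : Grassmann F ⊗[F] AQuot F ε k} (hu : IsElt ε k u) (hv : IsElt ε k v) :
    IsElt ε k (u + v) := by
  obtain ⟨h, hh, w, hw, rfl⟩ := hu
  obtain ⟨h', hh', w', hw', rfl⟩ := hv
  refine ⟨h + h', add_mem hh hh', w + w', add_mem hw hw', ?_⟩
  simp only [ex, TensorProduct.add_tmul]
  abel

theorem IsElt.smul {u : Grassmann F ⊗[F] AQuot F ε k} (hu : IsElt ε k u) (c : F) :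
    IsElt ε k (c • u) := by
  obtain ⟨h, hh, w, hw, rfl⟩ := hu
  exact ⟨c • h, Submodule.smul_mem _ _ hh, c • w, Submodule.smul_mem _ _ hw, by
    rw [ex, ex, smul_add, TensorProduct.smul_tmul']⟩

theorem isElt_of_mem_envelopePart {p : ZMod 2} {u : Grassmann F ⊗[F] AQuot F ε k}
    (hu : u ∈ envelopePart (quotSuper ε k) p) : IsElt ε k u := by
  unfold envelopePart at hu
  induction hu using Submodule.span_induction with
  | zero => exact isElt_of_mem (zero_mem _)
  | add a b _ _ ha hb => exact ha.add hb
  | smul c a _ ha => exact ha.smul c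
  | mem t ht =>
    obtain ⟨g, hg, _, ⟨a, ha, rfl⟩, rfl⟩ := ht
    change a ∈ aPart ε p at ha
    unfold aPart at ha
    induction ha using Submodule.span_induction with
    | zero => rw [map_zero, TensorProduct.tmul_zero]; exact isElt_of_mem (zero_mem _)
    | add a b _ _ ha hb => rw [map_add, TensorProduct.tmul_add]; exact ha.add hb
    | smul c a _ ha => rw [map_smul, TensorProduct.tmul_smul]; exact ha.smul c
    | mem t ht =>
      obtain ⟨b, rfl, rfl⟩ := ht
      cases b with
      | x => exact ⟨g, hg, 0, zero_mem _, (add_zero _).symm⟩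
      | a i j => exact isElt_of_mem (tmul_qa_mem (Nat.zero_le _) (by push_cast; exact hg))

theorem isElt_coe (u : envelope (quotSuper ε k)) :
    IsElt ε k (u : Grassmann F ⊗[F] AQuot F ε k) := by
  obtain ⟨a, ha, b, hb, h⟩ := Submodule.mem_sup.1
    (show (u : Grassmann F ⊗[F] AQuot F ε k) ∈ envelopePart (quotSuper ε k) 0 ⊔
      envelopePart (quotSuper ε k) 1 from u.2)
  rw [← h]
  exact (isElt_of_mem_envelopePart ha).add (isElt_of_mem_envelopePart hb)

theorem IsElt.mul_mem {u v : Grassmann F ⊗[F] AQuot F ε k} (hu : IsElt ε k u)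
    (hv : IsElt ε k v) : u * v ∈ envA ε k 0 := by
  obtain ⟨h, hh, w, hw, rfl⟩ := hu
  obtain ⟨h', hh', w', hw', rfl⟩ := hv
  rw [add_mul, mul_add, mul_add, envA_mul_envA hw hw', add_zero]
  exact add_mem (add_mem (ex_mul_ex_mem hh hh') (ex_mul_envA hw' hh)) (envA_mul_ex hw hh')

theorem IsElt.metabelian {a b c d : Grassmann F ⊗[F] AQuot F ε k} (ha : IsElt ε k a)
    (hb : IsElt ε k b) (hc : IsElt ε k c) (hd : IsElt ε k d) : a * b * (c * d) = 0 :=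
  envA_mul_envA (ha.mul_mem hb) (hc.mul_mem hd)

/-- On the a_{i,j} right multiplication by x merely shifts j, so only the order of the two odd
Grassmann factors matters. -/
theorem mul_ex_mul_ex {w : Grassmann F ⊗[F] AQuot F ε k} (hw : w ∈ envA ε k 0)
    {h h' : Grassmann F} (hh : h ∈ grassmannPart F 1) (hh' : h' ∈ grassmannPart F 1) :
    w * ex ε k h * ex ε k h' + w * ex ε k h' * ex ε k h = 0 := by
  unfold envA at hw
  induction hw using Submodule.span_induction with
  | zero => simp only [zero_mul, add_zero]
  | add a b _ _ ha hb =>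
    rw [← add_zero (0 : Grassmann F ⊗[F] AQuot F ε k)]
    nth_rewrite 1 [← ha]
    rw [← hb]
    simp only [add_mul]
    abel
  | smul c a _ ha => simp only [smul_mul_assoc, ← smul_add, ha, smul_zero]
  | mem t ht =>
    obtain ⟨i, j, g, _, _, rfl⟩ := ht
    rw [tmul_mul_ex, tmul_mul_ex, tmul_mul_ex, tmul_mul_ex, mul_assoc, mul_assoc,
      odd_mul_odd hh hh', mul_neg, TensorProduct.neg_tmul, add_neg_cancel]

include h2 in
theorem ex_flexible {w : Grassmann F ⊗[F] AQuot F ε k} (hw : w ∈ envA ε k 0)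
    (h : Grassmann F) {h' : Grassmann F} (hh' : h' ∈ grassmannPart F 1) :
    ex ε k h * w * ex ε k h' - ex ε k h * (w * ex ε k h') - ex ε k h * (ex ε k h' * w) = 0 := by
  unfold envA at hw
  induction hw using Submodule.span_induction with
  | zero => simp only [zero_mul, mul_zero, sub_zero]
  | add a b _ _ ha hb =>
    rw [← add_zero (0 : Grassmann F ⊗[F] AQuot F ε k)]
    nth_rewrite 1 [← ha]
    rw [← hb]
    simp only [add_mul, mul_add]
    abel
  | smul c a _ ha => simp only [smul_mul_assoc, mul_smul_comm, ← smul_sub, ha, smul_zero]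
  | mem t ht =>
    obtain ⟨i, j, g, hi, hg, rfl⟩ := ht
    simp only [ex, Algebra.TensorProduct.tmul_mul_tmul]
    rw [odd_mul_comm hg hh', mul_smul_comm, TensorProduct.smul_tmul, mul_assoc h g h',
      ← TensorProduct.tmul_sub, ← TensorProduct.tmul_sub, super_rightAlt ε k h2,
      TensorProduct.tmul_zero]

include h2 in
theorem IsElt.rightAlternative {a b c : Grassmann F ⊗[F] AQuot F ε k} (ha : IsElt ε k a)
    (hb : IsElt ε k b) (hc : IsElt ε k c) : ass a b c + ass a c b = 0 := by
  obtain ⟨h₁, hh₁, w₁, hw₁, rfl⟩ := ha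
  have hbc := hb.mul_mem hc
  have hcb := hc.mul_mem hb
  obtain ⟨h₂, hh₂, w₂, hw₂, rfl⟩ := hb
  obtain ⟨h₃, hh₃, w₃, hw₃, rfl⟩ := hc
  have s1 := mul_ex_mul_ex hw₁ hh₂ hh₃
  have s2 := ex_flexible h2 hw₂ h₁ hh₃
  have s3 := ex_flexible h2 hw₃ h₁ hh₂
  have s4 : ex ε k h₁ * ex ε k h₂ * ex ε k h₃ + ex ε k h₁ * ex ε k h₃ * ex ε k h₂ = 0 := by
    simp only [ex_mul_ex, smul_mul_assoc, tmul_mul_ex]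
    rw [mul_assoc, mul_assoc, odd_mul_odd hh₂ hh₃, mul_neg, TensorProduct.neg_tmul, smul_neg,
      add_neg_cancel]
  have s5 : ex ε k h₂ * ex ε k h₃ + ex ε k h₃ * ex ε k h₂ = 0 := by
    rw [ex_mul_ex, ex_mul_ex, odd_mul_odd hh₂ hh₃, TensorProduct.neg_tmul, smul_neg,
      add_neg_cancel]
  have z1 := envA_mul_envA hw₁ hbc
  have z2 := envA_mul_envA hw₁ hcb
  have z3 := envA_mul_envA hw₁ hw₂
  have z4 := envA_mul_envA hw₁ hw₃
  have z5 := envA_mul_envA hw₂ hw₃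
  have z6 := envA_mul_envA hw₃ hw₂
  have z7 := envA_mul_envA (ex_mul_envA hw₂ hh₁) hw₃
  have z8 := envA_mul_envA (ex_mul_envA hw₃ hh₁) hw₂
  have z9 := envA_mul_envA (envA_mul_ex hw₁ hh₂) hw₃
  have z10 := envA_mul_envA (envA_mul_ex hw₁ hh₃) hw₂
  have z11 := envA_mul_envA (ex_mul_ex_mem (ε := ε) (k := k) hh₁ hh₂) hw₃
  have z12 := envA_mul_envA (ex_mul_ex_mem (ε := ε) (k := k) hh₁ hh₃) hw₂
  have s5' : ex ε k h₁ * (ex ε k h₂ * ex ε k h₃) + ex ε k h₁ * (ex ε k h₃ * ex ε k h₂) = 0 := by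
    rw [← mul_add, s5, mul_zero]
  simp only [ass]
  rw [add_mul (ex ε k h₁) w₁ (_ * _), add_mul (ex ε k h₁) w₁ (_ * _), z1, z2]
  -- All terms with two factors from the span of the a's are gone. What remains has at most one `w`:
  -- `s1`, `s2`, `s3` treat `w₁`, `w₂`, `w₃`, and `s4`, `s5'` the terms in x alone.
  simp only [add_mul, mul_add, z3, z4, z5, z6, z7, z8, z9, z10, z11, z12, add_zero]
  have := congrArg₂ (· + ·) (congrArg₂ (· + ·) (congrArg₂ (· + ·) s1 s2) s3)
    (congrArg₂ (· - ·) s4 s5')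
  simp only [add_zero, sub_zero] at this
  rw [← this]
  abel

theorem com_isElt {w u : Grassmann F ⊗[F] AQuot F ε k} (hw : w ∈ envA ε k 0)
    {h : Grassmann F} {w' : Grassmann F ⊗[F] AQuot F ε k} (hw' : w' ∈ envA ε k 0)
    (hu : u = ex ε k h + w') : com w u = com w (ex ε k h) := by
  rw [hu, com, com, mul_add, add_mul, envA_mul_envA hw hw', envA_mul_envA hw' hw, add_zero,
    add_zero]

include h2 in
-- Brackets are taken in pairs: a single bracket on a_{i,j} with j odd still contains a term with
-- first index i.
theorem leftCom_mem_envA {p : ℕ} {w : Grassmann F ⊗[F] AQuot F ε k} (hw : w ∈ envA ε k p)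
    {v : ℕ → Grassmann F ⊗[F] AQuot F ε k} (hv : ∀ i, IsElt ε k (v i)) (m : ℕ) :
    leftCom w v (2 * m) ∈ envA ε k (p + 2 * m) := by
  induction m with
  | zero => exact hw
  | succ m ih =>
    obtain ⟨h, hh, w₁, hw₁, e₁⟩ := hv (2 * m)
    obtain ⟨h', hh', w₂, hw₂, e₂⟩ := hv (2 * m + 1)
    have ih0 := envA_anti (Nat.zero_le _) ih
    rw [show 2 * (m + 1) = 2 * m + 1 + 1 by ring, leftCom_succ, leftCom_succ,
      com_isElt ih0 hw₁ e₁, com_isElt (com_mem_envA ih0 hh) hw₂ e₂]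
    exact com_com_mem_envA h2 ih hh hh'

include h2 in
theorem leftCom_envA_eq_zero {w : Grassmann F ⊗[F] AQuot F ε k} (hw : w ∈ envA ε k 0)
    {v : ℕ → Grassmann F ⊗[F] AQuot F ε k} (hv : ∀ i, IsElt ε k (v i)) {m : ℕ}
    (hm : 2 * k ≤ m) : leftCom w v m = 0 :=
  leftCom_eq_zero_of_le hm (eq_zero_of_mem_envA (by omega) (leftCom_mem_envA h2 hw hv k))

include h2 in
-- The first bracket only brings the element into the span of the a's; the other 2k kill it.
theorem IsElt.leftCom_eq_zero {u : Grassmann F ⊗[F] AQuot F ε k} (hu : IsElt ε k u)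
    {v : ℕ → Grassmann F ⊗[F] AQuot F ε k} (hv : ∀ i, IsElt ε k (v i)) {m : ℕ}
    (hm : 2 * k + 1 ≤ m) : leftCom u v m = 0 := by
  obtain ⟨m, rfl⟩ := Nat.exists_eq_add_of_le' (show 1 ≤ m by omega)
  rw [leftCom_succ']
  exact leftCom_envA_eq_zero h2 (sub_mem (hu.mul_mem (hv 0)) ((hv 0).mul_mem hu))
    (fun i => hv (i + 1)) (by omega)

include h2 in
-- When x² = 0, the first bracket of h⊗x + w and h'⊗x + w' is [w, h'⊗x] - [w', h⊗x]. Both terms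
-- start inside the span of the a's, so this bracket already counts among the 2k.
theorem IsElt.leftCom_eq_zero_of_eps {u : Grassmann F ⊗[F] AQuot F ε k} (hε : ε = 0) (hk : 1 ≤ k)
    (hu : IsElt ε k u) {v : ℕ → Grassmann F ⊗[F] AQuot F ε k} (hv : ∀ i, IsElt ε k (v i)) {m : ℕ}
    (hm : 2 * k ≤ m) : leftCom u v m = 0 := by
  obtain ⟨m, rfl⟩ := Nat.exists_eq_add_of_le' (show 1 ≤ m by omega)
  obtain ⟨h, hh, w, hw, rfl⟩ := hu
  obtain ⟨h', hh', w', hw', e⟩ := hv 0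
  have key : com (ex ε k h + w) (v 0) = com w (ex ε k h') - com w' (ex ε k h) := by
    rw [e]
    simp only [com, add_mul, mul_add, ex_mul_ex, hε, zero_div, zero_smul, envA_mul_envA hw hw',
      envA_mul_envA hw' hw]
    abel
  have shift : ∀ (b : Grassmann F ⊗[F] AQuot F ε k) (g : Grassmann F), b ∈ envA ε k 0 →
      g ∈ grassmannPart F 1 → leftCom (com b (ex ε k g)) (fun i => v (i + 1)) m = 0 := by
    intro b g hb hg
    -- The bracket with `ex ε k g` is put back as the first entry of the sequence, restoring the
    -- count of m + 1 brackets.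
    have h1 := leftCom_envA_eq_zero h2 hb
      (v := fun i => Nat.casesOn i (ex ε k g) fun i => v (i + 1)) (by
        rintro (_ | i)
        · exact ⟨g, hg, 0, zero_mem _, (add_zero _).symm⟩
        · exact hv (i + 1)) hm
    rwa [leftCom_succ'] at h1
  rw [leftCom_succ', key, leftCom_sub, shift w h' hw hh', shift w' h hw' hh, sub_zero]

include h2 in
theorem leftCom_tmul {i j : ℕ} {g : Grassmann F}
    (hg : g ∈ grassmannPart F ((i + j : ℕ) : ZMod 2)) (s : ℕ → ℕ) (m : ℕ) :
    leftCom (g ⊗ₜ[F] qa ε k i j) (fun t => ex ε k (gen F (s t))) (2 * m) =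
      (g * genProd F ((List.range (2 * m)).map s)) ⊗ₜ[F] qa ε k (i + 2 * m) j := by
  induction m with
  | zero => simp [leftCom, genProd]
  | succ m ih =>
    rw [show 2 * (m + 1) = 2 * m + 1 + 1 by ring, leftCom_succ, leftCom_succ, ih,
      com_com_tmul h2 _ (gen_mem _) (gen_mem _), List.range_succ, List.range_succ]
    · simp only [List.map_append, List.map_cons, List.map_nil, genProd_append, genProd_singleton,
        mul_assoc]
      rfl
    · convert grassmannPart_mul hg (genProd_mem ((List.range (2 * m)).map s)) using 2
      simp only [List.length_map, List.length_range]
      push_cast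
      ring

theorem foldl_mul_ex (g : Grassmann F) (i j : ℕ) {v : ℕ → Grassmann F ⊗[F] AQuot F ε k}
    (l : List ℕ) (hv : ∀ t ∈ l, v t = ex ε k (gen F t)) :
    l.foldl (fun a t => a * v t) (g ⊗ₜ[F] qa ε k i j) =
      (g * genProd F l) ⊗ₜ[F] qa ε k i (j + l.length) := by
  induction l generalizing g j with
  | nil => simp [genProd]
  | cons a l ih =>
    rw [List.foldl_cons, hv a (by simp), tmul_mul_ex, ih _ _ fun t ht => hv t (by simp [ht])]
    simp only [genProd, List.map_cons, List.prod_cons, mul_assoc, List.length_cons, add_assoc,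
      add_comm 1]

end Envelope

/-! ## Identities of the Grassmann envelope -/

section Identities

variable {F : Type u} [Field F] {ε : F} {k n : ℕ}

theorem lift_coe_envelope (v : ℕ → envelope (quotSuper ε k)) (f : Poly F) :
    ((lift F v f : envelope (quotSuper ε k)) : Grassmann F ⊗[F] AQuot F ε k) =
      lift F (fun i => (v i : Grassmann F ⊗[F] AQuot F ε k)) f :=
  map_lift (NonUnitalSubalgebraClass.subtype (envelope (quotSuper ε k))) v f

theorem satisfies_of_isElt {f : Poly F} (h : ∀ v : ℕ → Grassmann F ⊗[F] AQuot F ε k,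
    (∀ i, IsElt ε k (v i)) → lift F v f = 0) : (envelopeAlg (quotSuper ε k)).Satisfies f := by
  intro v
  refine Subtype.ext ((lift_coe_envelope v f).trans ?_)
  exact h _ fun i => isElt_coe (v i)

theorem Alg.Satisfies.rightMul {A : Alg F} {f : Poly F} (h : A.Satisfies f) {m : ℕ}
    (j : Fin m → ℕ) : A.Satisfies (rightMul f j) := by
  intro v
  rw [lift_rightMul, h v]
  generalize List.ofFn j = l
  induction l with
  | nil => rfl
  | cons a l ih => rwa [List.foldl_cons, zero_mul]

theorem Alg.Satisfies.lieNil_of_le {A : Alg F} {m s : ℕ} (hms : m ≤ s)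
    (h : A.Satisfies (lieNil F m)) : A.Satisfies (lieNil F s) := by
  intro v
  have := h v
  rw [lift_lieNil] at this ⊢
  exact leftCom_eq_zero_of_le hms this

theorem RL_mono {m s : ℕ} (h : m ≤ s) : RL F m ≤ RL F s := by
  rintro A hA f (rfl | rfl | rfl)
  · exact hA _ (by simp)
  · exact hA _ (by simp)
  · exact (hA (lieNil F m) (by simp)).lieNil_of_le h

theorem IsElt.leftCom_eq_zero_of_le (h2 : (2 : F) ≠ 0) (hk : 1 ≤ k)
    (hn : n = 2 * k ∧ ε = 0 ∨ n = 2 * k + 1 ∧ ε = 1) {m : ℕ} (hm : n ≤ m)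
    {u : Grassmann F ⊗[F] AQuot F ε k} (hu : IsElt ε k u)
    {v : ℕ → Grassmann F ⊗[F] AQuot F ε k} (hv : ∀ i, IsElt ε k (v i)) : leftCom u v m = 0 := by
  rcases hn with ⟨rfl, h⟩ | ⟨rfl, h⟩
  · exact hu.leftCom_eq_zero_of_eps h2 h hk hv hm
  · exact hu.leftCom_eq_zero h2 hv hm

theorem quotSuper_mem_RL (h2 : (2 : F) ≠ 0) (hk : 1 ≤ k)
    (hn : n = 2 * k ∧ ε = 0 ∨ n = 2 * k + 1 ∧ ε = 1) : (quotSuper ε k).IsIn (RL F n) := by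
  rintro f (rfl | rfl | rfl) <;> refine satisfies_of_isElt fun v hv => ?_
  · have := (hv 0).rightAlternative h2 (hv 1) (hv 2)
    simpa only [rightAlt, ass, map_add, map_sub, map_mul, lift_x] using this
  · have := (hv 0).metabelian (hv 1) (hv 2) (hv 3)
    simpa only [metab, map_mul, lift_x] using this
  · rw [lift_lieNil]
    exact (hv 0).leftCom_eq_zero_of_le h2 hk hn le_rfl fun i => hv (i + 1)

theorem quotSuper_satisfies_phi (h2 : (2 : F) ≠ 0) (hk : 1 ≤ k)
    (hn : n = 2 * k ∧ ε = 0 ∨ n = 2 * k + 1 ∧ ε = 1) {m : ℕ} (hm : n ≤ m) :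
    (envelopeAlg (quotSuper ε k)).Satisfies (phi F m) := by
  refine satisfies_of_isElt fun v hv => ?_
  rw [lift_phi]
  split_ifs with hme
  · exact (hv 0).leftCom_eq_zero_of_le h2 hk hn hm fun i => hv (i + 1)
  -- Here m - 1 brackets act on a product, and m - 1 ≥ 2k because m is odd and m ≥ n ≥ 2k.
  · refine leftCom_envA_eq_zero h2 ((hv 0).mul_mem (hv 1)) (fun i => hv (i + 2)) ?_
    rw [Nat.not_even_iff] at hme
    omega

theorem ex_gen_mem (i : ℕ) : ex ε k (gen F i) ∈ envelope (quotSuper ε k) :=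
  Submodule.mem_sup_right (S := envelopePart (quotSuper ε k) 0) (Submodule.subset_span
    ⟨gen F i, gen_mem i, qx ε k, ⟨_, bas_mem_aPart ε .x rfl, rfl⟩, rfl⟩)

theorem one_tmul_qa_mem : (1 : Grassmann F) ⊗ₜ[F] qa ε k 0 0 ∈ envelope (quotSuper ε k) :=
  Submodule.mem_sup_left (T := envelopePart (quotSuper ε k) 1) (Submodule.subset_span
    ⟨1, one_mem_grassmannPart, qa ε k 0 0,
      ⟨_, bas_mem_aPart ε (.a 0 0) (by simp [Idx.parity]), rfl⟩, rfl⟩)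

/-- A nonzero value of `φ_{n-1}` on the Grassmann envelope. -/
theorem exists_lift_phi (h2 : (2 : F) ≠ 0) (hk : 1 ≤ k)
    (hn : n = 2 * k ∧ ε = 0 ∨ n = 2 * k + 1 ∧ ε = 1) :
    ∃ v : ℕ → Grassmann F ⊗[F] AQuot F ε k, (∀ i, v i ∈ envelope (quotSuper ε k)) ∧
      (∀ i, n ≤ i → v i = ex ε k (gen F i)) ∧ ∃ (l : List ℕ) (i j : ℕ), l.Nodup ∧
        (∀ t ∈ l, t < n) ∧ i < 2 * k ∧
        lift F v (phi F (n - 1)) = genProd F l ⊗ₜ[F] qa ε k i j := by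
  obtain ⟨k, rfl⟩ := Nat.exists_eq_add_of_le' hk
  have hgen : ∀ c : ℕ, ((List.range (2 * k)).map (· + c)).Nodup := fun c =>
    List.nodup_range.map (add_left_injective c)
  rcases hn with ⟨rfl, -⟩ | ⟨rfl, rfl⟩
  -- Now `k + 1` replaces the original k, and n = 2k+2. The product x₀x₁ becomes g₁⊗a_{0,1}, and the
  -- 2k brackets lead to a_{2k,1}.
  · refine ⟨fun i => if i = 0 then 1 ⊗ₜ[F] qa ε (k + 1) 0 0 else ex ε (k + 1) (gen F i),
      fun i => ?_, fun i hi => if_neg (by omega), [1] ++ (List.range (2 * k)).map (· + 2),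
      2 * k, 1, ?_, ?_, by omega, ?_⟩
    · dsimp only
      split_ifs
      · exact one_tmul_qa_mem
      · exact ex_gen_mem i
    · refine List.Nodup.append (List.nodup_singleton 1) (hgen 2) ?_
      simp
    · intro t ht
      simp only [List.mem_append, List.mem_singleton, List.mem_map, List.mem_range] at ht
      rcases ht with rfl | ⟨a, ha, rfl⟩ <;> omega
    · rw [lift_phi, if_neg (by rw [Nat.not_even_iff]; omega)]
      simp only [if_true, one_ne_zero, if_false, Nat.add_eq_zero_iff, OfNat.ofNat_ne_zero, and_false]
      rw [tmul_mul_ex, one_mul, show 2 * (k + 1) - 1 - 1 = 2 * k by omega,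
        leftCom_tmul h2 (by simpa using gen_mem 1), genProd_append, genProd_singleton, zero_add,
        zero_add]
  -- Here n = 2k+3. As ε = 1, the first bracket is g₀g₁⊗a_{0,0}, the second gives a_{1,0}, and the
  -- other 2k lead to a_{2k+1,0}.
  · refine ⟨fun i => ex 1 (k + 1) (gen F i), ex_gen_mem, fun i _ => rfl,
      [0, 1, 2] ++ (List.range (2 * k)).map (· + 3), 2 * k + 1, 0, ?_, ?_, by omega, ?_⟩
    · refine List.Nodup.append (by simp) (hgen 3) ?_
      simp
    · intro t ht
      simp only [List.mem_append, List.mem_cons, List.not_mem_nil, List.mem_map,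
        List.mem_range, or_false] at ht
      rcases ht with (rfl | rfl | rfl) | ⟨a, ha, rfl⟩ <;> omega
    · have h1 : com (ex (1 : F) (k + 1) (gen F 0)) (ex 1 (k + 1) (gen F 1)) =
          (gen F 0 * gen F 1) ⊗ₜ[F] qa 1 (k + 1) 0 (2 * 0) := by
        rw [com, ex_mul_ex, ex_mul_ex, odd_mul_odd (gen_mem 0) (gen_mem 1),
          TensorProduct.neg_tmul]
        match_scalars
        field_simp
        norm_num
      have hg : gen F 0 * gen F 1 ∈ grassmannPart F ((0 + 2 * 0 : ℕ) : ZMod 2) := by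
        rw [show ((0 + 2 * 0 : ℕ) : ZMod 2) = 1 + 1 from rfl]
        exact grassmannPart_mul (gen_mem 0) (gen_mem 1)
      have hg' : gen F 0 * gen F 1 * gen F 2 ∈ grassmannPart F ((0 + 1 + 2 * 0 : ℕ) : ZMod 2) :=
        odd_mul_mem hg (gen_mem 2)
      rw [lift_phi, if_pos (by rw [Nat.even_iff]; omega),
        show 2 * (k + 1) + 1 - 1 = 2 * k + 1 + 1 by omega, leftCom_succ', leftCom_succ']
      simp only [zero_add]
      rw [h1, com_tmul_even hg (gen_mem 2), genProd_append,
        show genProd F [0, 1, 2] = gen F 0 * gen F 1 * gen F 2 by simp [genProd, mul_assoc],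
        add_comm (2 * k)]
      exact leftCom_tmul h2 hg' (· + 3) k

/-- Starting from the nonzero value of φ_{n-1}, the right multiplications raise only the second
index. They append generators that are distinct and new because `j t ≥ n`, so the Grassmann factor
stays nonzero as well. -/
theorem quotSuper_not_satisfies (h2 : (2 : F) ≠ 0) (hk : 1 ≤ k)
    (hn : n = 2 * k ∧ ε = 0 ∨ n = 2 * k + 1 ∧ ε = 1) {m : ℕ} {j : Fin m → ℕ}
    (hj : Function.Injective j) (hjn : ∀ t, n ≤ j t) :
    ¬ (envelopeAlg (quotSuper ε k)).Satisfies (rightMul (phi F (n - 1)) j) := by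
  intro h
  obtain ⟨v, hv, hvn, l, a, b, hl, hln, ha, e⟩ := exists_lift_phi h2 hk hn
  let w : ℕ → envelope (quotSuper ε k) := fun i => ⟨v i, hv i⟩
  have h1 : lift F w (rightMul (phi F (n - 1)) j) = 0 := h w
  have h3 := lift_coe_envelope w (rightMul (phi F (n - 1)) j)
  rw [h1] at h3
  replace h3 : lift F v (rightMul (phi F (n - 1)) j) = 0 := h3.symm
  rw [lift_rightMul, e, foldl_mul_ex, ← genProd_append] at h3
  · refine qa_ne_zero ε k ha (genProd_tmul_eq_zero ?_ h3)
    refine hl.append (List.nodup_ofFn.2 hj) fun t ht ht' => ?_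
    obtain ⟨i, rfl⟩ := List.mem_ofFn.1 ht'
    exact absurd (hln _ ht) (not_lt.2 (hjn i))
  · intro t ht
    obtain ⟨i, rfl⟩ := List.mem_ofFn.1 ht
    exact hvn _ (hjn i)

end Identities

/-! ### Specialisation of the parameters to A^⟨n⟩ -/

section SuperA

variable {F : Type u} [Field F] {n : ℕ}

theorem superA_parameters (n : ℕ) : n = 2 * (n / 2) ∧ (if Even n then (0 : F) else 1) = 0 ∨
    n = 2 * (n / 2) + 1 ∧ (if Even n then (0 : F) else 1) = 1 := by
  by_cases h : Even n
  · exact Or.inl ⟨(Nat.two_mul_div_two_of_even h).symm, if_pos h⟩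
  · exact Or.inr ⟨(Nat.two_mul_div_two_add_one_of_odd (Nat.not_even_iff_odd.1 h)).symm, if_neg h⟩

variable (h2 : (2 : F) ≠ 0) (hn : 2 ≤ n)
include h2 hn

theorem superA_mem_RL : (superA F n).IsIn (RL F n) :=
  quotSuper_mem_RL h2 (by omega) (superA_parameters n)

theorem superA_satisfies_phi {m : ℕ} (hm : n ≤ m) :
    (envelopeAlg (superA F n)).Satisfies (phi F m) :=
  quotSuper_satisfies_phi h2 (by omega) (superA_parameters n) hm

theorem superA_not_satisfies {m : ℕ} {j : Fin m → ℕ} (hj : Function.Injective j)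
    (hjn : ∀ t, n ≤ j t) :
    ¬ (envelopeAlg (superA F n)).Satisfies (rightMul (phi F (n - 1)) j) :=
  quotSuper_not_satisfies h2 (by omega) (superA_parameters n) hj hjn

end SuperA

/-! ## Multilinearity of the defining identities -/

section Multilinear

variable {F : Type u} [Field F]

theorem isMultilinear_leftCom {c : ℕ} {f : Poly F} (hf : IsMultilinear (Finset.range c) f)
    (m : ℕ) : IsMultilinear (Finset.range (c + m)) (leftCom f (fun i => x F (i + c)) m) := by
  induction m with
  | zero => exact hf
  | succ m ih =>
    rw [← add_assoc, Finset.range_add_one, Finset.insert_eq, Finset.union_comm, leftCom_succ,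
      add_comm m c]
    exact ih.com (by simp) (.var _)

theorem isMultilinear_lieNil (s : ℕ) : IsMultilinear (Finset.range (1 + s)) (lieNil F s) :=
  isMultilinear_leftCom (c := 1) (Finset.range_one ▸ .var 0) s

theorem isMultilinear_phi (n : ℕ) : IsMultilinear (Finset.range (n + 1)) (phi F n) := by
  unfold phi
  split_ifs with h
  · rw [add_comm]
    exact isMultilinear_leftCom (c := 1) (Finset.range_one ▸ .var 0) n
  · obtain ⟨n, rfl⟩ := Nat.exists_eq_add_of_le' (Nat.not_even_iff_odd.1 h).pos
    rw [show n + 1 + 1 = 2 + n by ring]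
    exact isMultilinear_leftCom (c := 2) ((IsMultilinear.var 0).mul (by decide) (.var 1)) n

theorem isMultilinear_rightAlt : IsMultilinear {0, 1, 2} (rightAlt F) := by
  have h : ∀ i j l : ℕ, i ≠ j → i ≠ l → j ≠ l →
      IsMultilinear {i, j, l} (ass (x F i) (x F j) (x F l)) := by
    intro i j l hij hil hjl
    have hi := IsMultilinear.var (F := F) i
    have hj := IsMultilinear.var (F := F) j
    have hl := IsMultilinear.var (F := F) l
    have h1 := (hi.mul (by simpa using hij) hj).mul (by simp [hil.symm, hjl.symm]) hl
    have h3 := hi.mul (by simp [hij, hil]) (hj.mul (by simpa using hjl) hl)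
    rw [Finset.union_assoc] at h1
    exact h1.sub h3
  refine (h 0 1 2 (by decide) (by decide) (by decide)).add ?_
  rw [Finset.pair_comm 1 2]
  exact h 0 2 1 (by decide) (by decide) (by decide)

theorem isMultilinear_metab : IsMultilinear ({0} ∪ {1} ∪ ({2} ∪ {3})) (metab F) :=
  ((IsMultilinear.var 0).mul (by decide) (.var 1)).mul (by decide)
    ((IsMultilinear.var 2).mul (by decide) (.var 3))

/-- The polynomial `φ_n R_{x_{n+1}} ⋯ R_{x_{n+2k}}`. -/
def phiR (F : Type u) [Field F] (n k : ℕ) : Poly F :=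
  rightMul (phi F n) fun t : Fin (2 * k) => n + 1 + t

theorem isMultilinear_rightMul {c : ℕ} {f : Poly F} (hf : IsMultilinear (Finset.range c) f)
    (m : ℕ) : IsMultilinear (Finset.range (c + m)) (rightMul f fun t : Fin m => c + t) := by
  induction m with
  | zero => exact hf
  | succ m ih =>
    rw [← add_assoc, Finset.range_add_one, Finset.insert_eq, Finset.union_comm]
    have : (rightMul f fun t : Fin (m + 1) => c + t) =
        (rightMul f fun t : Fin m => c + t) * x F (c + m) := by
      rw [rightMul, List.ofFn_succ', List.concat_eq_append, List.foldl_append]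
      rfl
    rw [this]
    exact ih.mul (by simp) (.var _)

theorem isMultilinear_phiR (n k : ℕ) :
    IsMultilinear (Finset.range (n + 1 + 2 * k)) (phiR F n k) :=
  isMultilinear_rightMul (isMultilinear_phi n) _

theorem IndepOf.lift_congr {f : Poly F} {J : Set ℕ} (hf : IndepOf f J) {A : Type u}
    [NonUnitalNonAssocRing A] [Module F A] [IsScalarTower F A A] [SMulCommClass F A A]
    {v w : ℕ → A} (h : ∀ i ∉ J, v i = w i) : lift F v f = lift F w f := by
  unfold IndepOf at hf
  induction hf using NonUnitalAlgebra.adjoin_induction with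
  | mem y hy =>
    obtain ⟨i, hi, rfl⟩ := hy
    simpa using h i hi
  | add a b _ _ ha hb => rw [map_add, map_add, ha, hb]
  | zero => rw [map_zero, map_zero]
  | mul a b _ _ ha hb => rw [map_mul, map_mul, ha, hb]
  | smul c a _ ha => rw [map_smul, map_smul, ha]

/-- A multilinear polynomial that does not depend on one of its variables is an identity. -/
theorem IsMultilinear.satisfies_of_indepOf {s : Finset ℕ} {f : Poly F} (hf : IsMultilinear s f)
    {J : Set ℕ} (hJ : IndepOf f J) {i : ℕ} (his : i ∈ s) (hiJ : i ∈ J) (A : Alg F) :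
    A.Satisfies f := by
  intro v
  rw [hJ.lift_congr (w := Function.update v i 0) fun a ha =>
    (Function.update_of_ne (fun h => ha (by rwa [h])) _ _).symm]
  exact hf.lift_eq_zero his (Function.update_self _ _ _)

end Multilinear

/-! ## Allotted varieties -/

section Allotted

variable {F : Type u} [Field F] {n : ℕ}

theorem rightMul_zero {m : ℕ} (j : Fin m → ℕ) : rightMul (0 : Poly F) j = 0 := by
  unfold rightMul
  generalize List.ofFn j = l
  induction l with
  | nil => rfl
  | cons a l ih => rwa [List.foldl_cons, zero_mul]

theorem isIdentity_generatedBy_iff {A : Alg F} {f : Poly F} :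
    (Variety.generatedBy A).IsIdentity f ↔ A.Satisfies f :=
  ⟨fun h => h A fun _ hg => hg, fun h _ hB => hB f h⟩

theorem generatedBy_le {A : Alg F} {S : Set (Poly F)} (h : A ∈ (Variety.ofIdentities S).algs) :
    Variety.generatedBy A ≤ Variety.ofIdentities S :=
  fun _ hB f hf => hB f (h f hf)

theorem isAllotted_superA (h2 : (2 : F) ≠ 0) (hn : 2 ≤ n) {s : ℕ} (hs : n ≤ s) :
    IsAllotted s n (Variety.generatedBy (envelopeAlg (superA F n))) := by
  refine ⟨by omega, hs, (generatedBy_le (superA_mem_RL h2 hn)).trans (RL_mono hs),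
    Or.inr ⟨0, Fin.elim0, fun t => t.elim0, zero_mem _, ?_⟩⟩
  rw [rightMul_zero, sub_zero, isIdentity_generatedBy_iff]
  exact superA_satisfies_phi h2 hn le_rfl

theorem not_isAllotted_superA (h2 : (2 : F) ≠ 0) (hn : 2 ≤ n) (s : ℕ) :
    ¬ IsAllotted s (n - 1) (Variety.generatedBy (envelopeAlg (superA F n))) := by
  have h0 : ¬ (envelopeAlg (superA F n)).Satisfies (phi F (n - 1)) := fun h =>
    superA_not_satisfies h2 hn (j := Fin.elim0) (fun t => t.elim0) (fun t => t.elim0)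
      (h.rightMul _)
  -- The relation means either 0 = φR⋯R or φ = 0R⋯R = 0; both must be excluded.
  rintro ⟨-, -, -, ⟨k, j, hj, hind, hid⟩ | ⟨k, j, -, -, hid⟩⟩
  · rw [isIdentity_generatedBy_iff] at hid
    have hid' : (envelopeAlg (superA F n)).Satisfies (rightMul (phi F (n - 1)) j) := by
      intro v
      have := hid v
      rwa [map_sub, map_zero, zero_sub, neg_eq_zero] at this
    refine superA_not_satisfies h2 hn hj (fun t => ?_) hid'
    by_contra! hlt
    -- If some x_{j t} were a variable of φ, then φ would be multilinear in a variable on which it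
    -- does not depend, hence an identity.
    exact h0 ((isMultilinear_phi (n - 1)).satisfies_of_indepOf hind
      (Finset.mem_range.2 (by omega)) (Set.mem_range_self t) _)
  · rw [rightMul_zero, sub_zero, isIdentity_generatedBy_iff] at hid
    exact h0 hid

end Allotted

/-! ## The topological rank -/

section Rank

variable {F : Type u} [Field F] {n : ℕ}

/-- The identities `φ_j R^{2 κ_j} = 0` for `m ≤ j < n` together with those of `RL_n`. -/
def allottedIdentities (F : Type u) [Field F] (n : ℕ) (κ : ℕ → ℕ) (m : ℕ) : Set (Poly F) :=
  {rightAlt F, metab F, lieNil F n} ∪ {f | ∃ j, m ≤ j ∧ j < n ∧ f = phiR F j (κ j)}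

/-- The subvariety of `RL_n` defined by the identities `φ_j R^{2 κ_j} = 0` for `m ≤ j < n`. -/
def allottedVariety (F : Type u) [Field F] (n : ℕ) (κ : ℕ → ℕ) (m : ℕ) : Subvarieties (RL F n) :=
  ⟨Variety.ofIdentities (allottedIdentities F n κ m), fun _ hA f hf => hA f (Or.inl hf)⟩

theorem isMultilinear_of_mem {κ : ℕ → ℕ} {m : ℕ} {f : Poly F}
    (hf : f ∈ allottedIdentities F n κ m) : ∃ s, IsMultilinear s f := by
  rcases hf with (rfl | rfl | rfl) | ⟨j, -, -, rfl⟩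
  · exact ⟨_, isMultilinear_rightAlt⟩
  · exact ⟨_, isMultilinear_metab⟩
  · exact ⟨_, isMultilinear_lieNil n⟩
  · exact ⟨_, isMultilinear_phiR j _⟩

theorem allottedIdentities_update {κ : ℕ → ℕ} {m : ℕ} (hm : m < n) (k : ℕ) :
    allottedIdentities F n (Function.update κ m k) m =
      allottedIdentities F n κ (m + 1) ∪ {phiR F m k} := by
  unfold allottedIdentities
  rw [Set.union_assoc]
  congr 1
  ext f
  constructor
  · rintro ⟨j, hj, hjn, rfl⟩
    rcases hj.eq_or_lt with rfl | hlt
    · right; simp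
    · exact Or.inl ⟨j, hlt, hjn, by rw [Function.update_of_ne (by omega)]⟩
  · rintro (⟨j, hj, hjn, rfl⟩ | rfl)
    · exact ⟨j, by omega, hjn, by rw [Function.update_of_ne (by omega)]⟩
    · exact ⟨m, le_rfl, hm, by rw [Function.update_self]⟩

theorem superA_mem_allottedVariety (h2 : (2 : F) ≠ 0) {m : ℕ} (hm : 2 ≤ m) (hmn : m ≤ n)
    (κ : ℕ → ℕ) : envelopeAlg (superA F m) ∈ (allottedVariety F n κ m).1.algs := by
  rintro f (hf | ⟨j, hj, -, rfl⟩)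
  · exact RL_mono hmn (superA_mem_RL h2 hm) f hf
  · exact (superA_satisfies_phi h2 hm hj).rightMul _

/-- The exponents `κ` are arbitrary because the approximating varieties change one of them. -/
theorem allottedVariety_mem_derived (h2 : (2 : F) ≠ 0) (r : ℕ) :
    ∀ m, r < m → m ≤ n → ∀ κ, allottedVariety F n κ m ∈ derived^[r] Set.univ := by
  induction r with
  | zero => exact fun _ _ _ _ => trivial
  | succ r ih =>
    intro m hrm hmn κ
    rw [Function.iterate_succ_apply']
    refine mem_derived (ih m (by omega) hmn κ) fun N => ?_
    obtain ⟨m, rfl⟩ := Nat.exists_eq_add_of_le' (show 1 ≤ m by omega)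
    have hS := allottedIdentities_update (F := F) (n := n) (κ := κ) (m := m) hmn N
    refine ⟨allottedVariety F n (Function.update κ m N) m, ih m (by omega) (by omega) _,
      lt_of_le_not_ge ?_ ?_, ?_⟩
    · intro A hA f hf
      exact hA f (hS.ge (Or.inl hf))
    -- The approximation is proper: the envelope of A^⟨m+1⟩ satisfies φ_j = 0 for all j > m, but not
    -- φ_m R^{2N} = 0.
    · intro hle
      have h1 := hle (superA_mem_allottedVariety h2 (by omega) hmn κ) (phiR F m N)
        (hS.ge (Or.inr rfl))
      refine superA_not_satisfies h2 (n := m + 1) (by omega) ?_ (fun t => ?_) h1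
      · exact fun s t hst => Fin.ext (by simpa using hst)
      · exact Nat.le_add_right _ _
    · intro f d hd hf hid
      -- The added identity has degree m + 1 + 2N > N.
      refine isIdentity_of_isIdentity_union (T := {phiR F m N}) (d := N)
        (fun _ hg => isMultilinear_of_mem hg) ?_ hd hf (by rw [← hS]; exact hid)
      rintro _ rfl
      exact ⟨_, isMultilinear_phiR m N, by rw [Finset.card_range]; omega⟩

/-- For m = n no index j satisfies m ≤ j < n, so the surviving point is RL_n itself, whatever the
exponents. -/
theorem le_topRank_RL (h2 : (2 : F) ≠ 0) (n : ℕ) : (n : ℕ∞) ≤ topRank (RL F n) :=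
  le_topRankSet fun r hr => ⟨_, allottedVariety_mem_derived h2 r n hr le_rfl 0⟩

end Rank

end

end SuperRank

theorem mainTheorem3 {F : Type u} [Field F] (h2 : ringChar F ≠ 2) (h3 : ringChar F ≠ 3)
    (n : ℕ) (hn : 2 ≤ n) :
    (SuperRank.superA F n).IsIn (SuperRank.RL F n) ∧
    (∀ s : ℕ, n ≤ s →
      SuperRank.IsAllotted s n
        (SuperRank.Variety.generatedBy (SuperRank.envelopeAlg (SuperRank.superA F n))) ∧
      ¬ SuperRank.IsAllotted s (n - 1)
        (SuperRank.Variety.generatedBy (SuperRank.envelopeAlg (SuperRank.superA F n)))) ∧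
    (n : ℕ∞) ≤ SuperRank.topRank (SuperRank.RL F n) := by
  have h2' : (2 : F) ≠ 0 := Ring.two_ne_zero h2
  exact ⟨SuperRank.superA_mem_RL h2' hn, fun s hs => ⟨SuperRank.isAllotted_superA h2' hn hs,
    SuperRank.not_isAllotted_superA h2' hn s⟩, SuperRank.le_topRank_RL h2' n⟩
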